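/- Call a commutative ring $\mathcal O$ a quadratic order if it is an order in a quadratic field, i.e. an integral domain that is free of rank $2$ as a $\mathbb Z$-module; it is imaginary if $\mathrm{Disc}(\mathcal O)<0$ and real if $\mathrm{Disc}(\mathcal O)>0$. Let $\mathcal I(\mathcal O)$ be the group of invertible fractional ideals of $\mathcal O$, and let $\mathcal I_3(\mathcal O)=\{I\in\mathcal I(\mathcal O): I^3=\mathcal O\}$ be its $3$-torsion subgroup. Then every $\mathcal I_3(\mathcal O)$ is finite, for each $X$ there are only finitely many isomorphism classes of quadratic orders with $|\mathrm{Disc}(\mathcal O)|<X$, and \[ \lim_{X\to\infty}\frac{\sum_{0<-\mathrm{Disc}(\mathcal O)<X}|\mathcal I_3(\mathcal O)|}{\sum_{0<-\mathrm{Disc}(\mathcal O)<X}1}=\frac{\zeta(2)}{\zeta(3)} \qquad\text{and}\qquad \lim_{X\to\infty}\frac{\sum_{0<\mathrm{Disc}(\mathcal O)<X}|\mathcal I_3(\mathcal O)|}{\sum_{0<\mathrm{Disc}(\mathcal O)<X}1}=\frac{\zeta(2)}{\zeta(3)}, \] where the sums run over isomorphism classes of imaginary, respectively real, quadratic orders,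 and $\zeta$ is the Riemann zeta function. -/

import Mathlib

open Filter Topology
open scoped nonZeroDivisors

/-- An order in a quadratic field, as an abstract ring: a commutative ring with unit that is free
of rank `2` as a `ℤ`-module (a quadratic ring) and is an integral domain.  Its fraction field is
the quadratic field in which it is an order. -/
structure QuadraticOrder where
  carrier : Type
  [commRing : CommRing carrier]
  [isDomain : IsDomain carrier]
  [free : Module.Free ℤ carrier]
  finrank_eq_two : Module.finrank ℤ carrier = 2

namespace QuadraticOrder

attribute [instance] commRing isDomain free

instance moduleFinite (O : QuadraticOrder) : Module.Finite ℤ O.carrier :=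
  Module.finite_of_finrank_pos (by rw [O.finrank_eq_two]; norm_num)

/-- The discriminant: the determinant of the trace form on a `ℤ`-basis. -/
noncomputable def discr (O : QuadraticOrder) : ℤ :=
  Algebra.discr ℤ (Module.finBasisOfFinrankEq ℤ O.carrier O.finrank_eq_two)

/-- The discriminant may be computed in any `ℤ`-basis. -/
theorem discr_eq (O : QuadraticOrder) (b : Module.Basis (Fin 2) ℤ O.carrier) :
    O.discr = Algebra.discr ℤ b :=
  Algebra.discr_eq_discr O.carrier _ b

/-- The ideal group of an order: the group of its invertible fractional ideals. -/
abbrev IdealGroup (O : QuadraticOrder) : Type :=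
  (FractionalIdeal O.carrier⁰ (FractionRing O.carrier))ˣ

/-- The `3`-torsion subgroup of the ideal group: the `I` with `I ^ 3 = O`. -/
def idealThreeTorsion (O : QuadraticOrder) : Subgroup O.IdealGroup where
  carrier := {I | I ^ 3 = 1}
  one_mem' := one_pow 3
  mul_mem' {I J} hI hJ := by
    change (I * J) ^ 3 = 1
    rw [mul_pow, show I ^ 3 = 1 from hI, show J ^ 3 = 1 from hJ, one_mul]
  inv_mem' {I} hI := by
    change I⁻¹ ^ 3 = 1
    rw [inv_pow, show I ^ 3 = 1 from hI, inv_one]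

/-- Isomorphism of orders is isomorphism of rings. -/
instance setoid : Setoid QuadraticOrder where
  r O O' := Nonempty (O.carrier ≃+* O'.carrier)
  iseqv :=
    { refl := fun _ => ⟨RingEquiv.refl _⟩
      symm := fun ⟨e⟩ => ⟨e.symm⟩
      trans := fun ⟨e⟩ ⟨f⟩ => ⟨e.trans f⟩ }

theorem discr_congr {O O' : QuadraticOrder} (h : O ≈ O') : O.discr = O'.discr := by
  obtain ⟨e⟩ := h
  let f : O.carrier ≃ₐ[ℤ] O'.carrier := AlgEquiv.ofRingEquiv (f := e) fun _ => by simp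
  let b := Module.finBasisOfFinrankEq ℤ O.carrier O.finrank_eq_two
  rw [O'.discr_eq (b.map f.toLinearEquiv)]
  exact Algebra.discr_eq_discr_of_algEquiv b f

theorem card_idealThreeTorsion_congr {O O' : QuadraticOrder} (h : O ≈ O') :
    Nat.card O.idealThreeTorsion = Nat.card O'.idealThreeTorsion := by
  obtain ⟨e⟩ := h
  let F : O.IdealGroup ≃* O'.IdealGroup := Units.mapEquiv
    (FractionalIdeal.ringEquivOfRingEquiv (FractionRing O.carrier)
      (FractionRing O'.carrier) e).toMulEquiv
  refine Nat.card_congr (F.toEquiv.subtypeEquiv fun I => ?_)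
  change I ^ 3 = 1 ↔ F I ^ 3 = 1
  rw [← map_pow, map_eq_one_iff F F.injective]

end QuadraticOrder

/-- The isomorphism classes of orders in quadratic fields. -/
abbrev QuadraticOrderClass : Type 1 := Quotient QuadraticOrder.setoid

namespace QuadraticOrderClass

/-- The discriminant of an isomorphism class of quadratic orders. -/
noncomputable def discr : QuadraticOrderClass → ℤ :=
  Quotient.lift QuadraticOrder.discr fun _ _ h => QuadraticOrder.discr_congr h

/-- The number of `3`-torsion elements in the ideal group of an order in the given class. -/
noncomputable def numIdealThreeTorsion : QuadraticOrderClass → ℕ :=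
  Quotient.lift (fun O => Nat.card O.idealThreeTorsion)
    fun _ _ h => QuadraticOrder.card_idealThreeTorsion_congr h

/-- The classes of imaginary quadratic orders with `|Disc| < X`. -/
def imaginaryBelow (X : ℝ) : Set QuadraticOrderClass :=
  {O | 0 < -O.discr ∧ ((-O.discr : ℤ) : ℝ) < X}

/-- The classes of real quadratic orders with `|Disc| < X`. -/
def realBelow (X : ℝ) : Set QuadraticOrderClass :=
  {O | 0 < O.discr ∧ (O.discr : ℝ) < X}

/-- The average number of `3`-torsion elements in the ideal group, over the orders in `S`
(meaningful when `S` is finite and nonempty). -/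
noncomputable def averageIdealThreeTorsion (S : Set QuadraticOrderClass) : ℝ :=
  (∑ᶠ O ∈ S, (O.numIdealThreeTorsion : ℝ)) / (S.ncard : ℝ)

end QuadraticOrderClass

/-!
Let `O` be the order of discriminant `D` in the quadratic field `K`. The fractional ideals `I` with
`I ^ 3 = O` are parametrised explicitly, without class groups or localisations. Such an `I` is a
lattice `ℤ m + ℤ α`, where `m > 0` generates `I ∩ ℚ`, and comparing `I ^ 3` with `O` forces
`α = (t + √D / m) / 2` with `t` an integer coprime to `m` and `4 m³ ∣ D + 3 m² t²`. Conversely, each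
such pair `(m, t)` gives a cube root of `O`, because `I ^ 3` is contained in `O` and contains the
coprime integers `m ^ 3` and `N(α) ^ 3`; and `I` determines `m`, and `t` modulo `2m`
(`exists_eq_latticeIdeal`, `latticeIdeal_pow_three`, `latticeIdeal_inj`).
Hence the number of `3`-torsion ideals is the number of pairs `(m, t mod 2m)` satisfying this
condition.

Isomorphism classes of orders correspond to the non-square `D` congruent to `0` or `1` modulo `4`
(`discr_injective`, `range_discr`), so the average becomes a count of triples `(D, m, t)`.
For fixed `m` there are `2 φ(m)` values of `t`, each of which puts `D` in one residue class modulo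
`4 m³`, so that the contribution of `m` has density `φ(m) / (2 m³)` (`tendsto_levelSum_div`);
removing the square discriminants does not change it. The level `m = 1` contributes exactly one
to each order, so it counts the orders, with density `1 / 2`. The sum over `m` may be exchanged with
the limit by dominated convergence: the congruence `3 t² ≡ 3 t₀²` modulo `m` has `O(d(m))`
solutions coprime to `m` (`rootCount_le`), and `m² ∣ D`, which bounds the density by a multiple of
`d(m) / m²` (`levelSum_div_le`). The average is therefore `∑ φ(m) / m³ = ζ(2) / ζ(3)`
(`tsum_totient_div_cube`), whatever the sign of `D`.
-/

/-! ### The order `ℤ[ω]` in the field `ℚ(ω)` -/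

namespace QuadraticAlgebra

variable {a b : ℤ}

/-- The inclusion of the order `ℤ[ω]` in its field of fractions `ℚ(ω)`, where `ω² = a + bω`. -/
def intToRat (a b : ℤ) : QuadraticAlgebra ℤ a b →+* QuadraticAlgebra ℚ a b where
  toFun z := ⟨z.re, z.im⟩
  map_one' := by ext <;> simp [re_one, im_one]
  map_zero' := by ext <;> simp
  map_add' x y := by ext <;> simp
  map_mul' x y := by ext <;> simp

instance algebraIntRat : Algebra (QuadraticAlgebra ℤ a b) (QuadraticAlgebra ℚ a b) :=
  (intToRat a b).toAlgebra

theorem algebraMap_intRat (z : QuadraticAlgebra ℤ a b) :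
    algebraMap (QuadraticAlgebra ℤ a b) (QuadraticAlgebra ℚ a b) z = ⟨z.re, z.im⟩ := rfl

theorem smul_intRat (z : QuadraticAlgebra ℤ a b) (x : QuadraticAlgebra ℚ a b) :
    z • x = ⟨z.re, z.im⟩ * x := rfl

theorem algebraMap_intRat_injective : Function.Injective
    (algebraMap (QuadraticAlgebra ℤ a b) (QuadraticAlgebra ℚ a b)) := by
  intro x y h
  simp only [algebraMap_intRat, QuadraticAlgebra.ext_iff, Int.cast_inj] at h
  exact QuadraticAlgebra.ext h.1 h.2

instance : FaithfulSMul (QuadraticAlgebra ℤ a b) (QuadraticAlgebra ℚ a b) :=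
  (faithfulSMul_iff_algebraMap_injective _ _).2 algebraMap_intRat_injective

/-- The polynomial `X² - bX - a` has no rational root as soon as its discriminant is not a
square. -/
theorem fact_of_not_isSquare (h : ¬ IsSquare (b ^ 2 + 4 * a)) :
    Fact (∀ r : ℚ, r ^ 2 ≠ a + b * r) := by
  refine ⟨fun r hr => h ?_⟩
  rw [← Rat.isSquare_intCast_iff]
  refine ⟨2 * r - b, ?_⟩
  push_cast
  linear_combination -4 * hr

variable [Fact (∀ r : ℚ, r ^ 2 ≠ a + b * r)]

instance isDomain_int : IsDomain (QuadraticAlgebra ℤ a b) :=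
  algebraMap_intRat_injective.isDomain _

instance isFractionRing_intRat :
    IsFractionRing (QuadraticAlgebra ℤ a b) (QuadraticAlgebra ℚ a b) := by
  refine IsFractionRing.of_field _ _ fun z => ?_
  refine ⟨⟨z.re.num * z.im.den, z.im.num * z.re.den⟩, ⟨z.re.den * z.im.den, 0⟩, ?_⟩
  have h1 := z.re.den_nz
  have h2 := z.im.den_nz
  have h3 : (⟨(z.re.den * z.im.den : ℚ), 0⟩ : QuadraticAlgebra ℚ a b) ≠ 0 := by
    intro h
    simp [QuadraticAlgebra.ext_iff] at h
  simp only [algebraMap_intRat]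
  push_cast
  rw [eq_div_iff h3]
  ext
  · simp
    nth_rw 1 [← Rat.num_div_den z.re]
    field_simp
  · simp
    nth_rw 1 [← Rat.num_div_den z.im]
    field_simp

end QuadraticAlgebra

/-- A rational number whose cube satisfies a monic equation `x³ = ux + v` over `ℤ` is an
integer. -/
theorem Rat.exists_int_of_cubic {x : ℚ} {u v : ℤ} (h : x ^ 3 = u * x + v) : ∃ n : ℤ, x = n := by
  have hx : IsIntegral ℤ x := by
    refine ⟨Polynomial.X ^ 3 - (Polynomial.C u * Polynomial.X + Polynomial.C v), ?_, ?_⟩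
    · apply Polynomial.monic_X_pow_sub
      compute_degree!
    · simp only [Polynomial.eval₂_sub, Polynomial.eval₂_add, Polynomial.eval₂_mul,
        Polynomial.eval₂_C, Polynomial.eval₂_X_pow, Polynomial.eval₂_X, h]
      simp
  obtain ⟨n, hn⟩ := IsIntegrallyClosed.isIntegral_iff.1 hx
  exact ⟨n, by simpa using hn.symm⟩

namespace QuadraticOrder
open QuadraticAlgebra
variable {a b : ℤ}

/-! ### The cube roots given by pairs `(m, t)` -/

/-- The element `(t + √D / m) / 2` of `ℚ(ω)`, of trace `t`, where `√D = 2ω - b`. -/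
def latticeGen (a b : ℤ) (m t : ℤ) : QuadraticAlgebra ℚ a b := ⟨(t - b / m) / 2, 1 / m⟩

/-- The conditions on `(m, t)` under which the lattice `ℤm + ℤ(t + √D / m) / 2` is a fractional
ideal whose cube is the order of discriminant `D`. -/
structure IsCubeRootPair (D m t : ℤ) : Prop where
  pos : 0 < m
  coprime : IsCoprime m t
  dvd : 4 * m ^ 3 ∣ D + 3 * m ^ 2 * t ^ 2

/-- With `4 m ^ 3 k = D + 3 m² t²`, the generator `α` has trace `t` and norm `t² - m k`; the order
is `ℤ + ℤ m α`. -/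
theorem latticeGen_sq {m t k : ℤ} (hm : m ≠ 0)
    (hk : b ^ 2 + 4 * a + 3 * m ^ 2 * t ^ 2 = 4 * m ^ 3 * k) :
    latticeGen a b m t * latticeGen a b m t =
      t * latticeGen a b m t - ((t ^ 2 - m * k : ℤ) : QuadraticAlgebra ℚ a b) := by
  have hm' : (m : ℚ) ≠ 0 := by exact_mod_cast hm
  have hk' : (b ^ 2 + 4 * a + 3 * m ^ 2 * t ^ 2 : ℚ) = 4 * m ^ 3 * k := by exact_mod_cast hk
  obtain ⟨n, hn⟩ : ∃ n, n = t ^ 2 - m * k := ⟨_, rfl⟩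
  have hn' : (n : ℚ) = t ^ 2 - m * k := by exact_mod_cast hn
  rw [← hn]
  ext
  · simp [latticeGen, hn']
    field_simp
    linear_combination hk'
  · simp [latticeGen]
    field_simp
    ring

/-- The order is contained in `ℤ + ℤ m α`; the parity of `b - m t` makes `r` an integer. -/
theorem omega_eq_latticeGen {m t k : ℤ} (hm : m ≠ 0)
    (hk : b ^ 2 + 4 * a + 3 * m ^ 2 * t ^ 2 = 4 * m ^ 3 * k) :
    ∃ r : ℤ, (⟨0, 1⟩ : QuadraticAlgebra ℚ a b) = r + m * latticeGen a b m t := by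
  have hm' : (m : ℚ) ≠ 0 := by exact_mod_cast hm
  have h2 : (2 : ℤ) ∣ b - m * t := by
    have : Even ((b - m * t) ^ 2) := by
      refine ⟨2 * m ^ 3 * k - 2 * a - m ^ 2 * t ^ 2 - b * m * t, ?_⟩
      linear_combination hk
    exact even_iff_two_dvd.1 ((Int.even_pow' two_ne_zero).1 this)
  obtain ⟨r, hr⟩ := h2
  have hr' : (b - m * t : ℚ) = 2 * r := by exact_mod_cast hr
  refine ⟨r, ?_⟩
  ext
  · simp [latticeGen]
    field_simp
    linear_combination hr'
  · simp [latticeGen, hm']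

/-- An element of the order is one with integral coordinates. -/
theorem mem_one_iff_coord (z : QuadraticAlgebra ℚ a b) : z ∈
    (1 : FractionalIdeal (QuadraticAlgebra ℤ a b)⁰ (QuadraticAlgebra ℚ a b)) ↔
    ∃ p q : ℤ, z = ⟨p, q⟩ := by
  rw [FractionalIdeal.mem_one_iff]
  constructor
  · rintro ⟨w, rfl⟩
    exact ⟨w.re, w.im, rfl⟩
  · rintro ⟨p, q, rfl⟩
    exact ⟨⟨p, q⟩, rfl⟩

variable [Fact (∀ r : ℚ, r ^ 2 ≠ a + b * r)]

/-- The fractional ideal generated by `m` and `(t + √D / m) / 2`. -/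
noncomputable def latticeIdeal (a b : ℤ) [Fact (∀ r : ℚ, r ^ 2 ≠ a + b * r)] (m t : ℤ) :
    FractionalIdeal (QuadraticAlgebra ℤ a b)⁰ (QuadraticAlgebra ℚ a b) :=
  FractionalIdeal.spanSingleton _ (m : QuadraticAlgebra ℚ a b) +
    FractionalIdeal.spanSingleton _ (latticeGen a b m t)

theorem mem_latticeIdeal {m t : ℤ} (h : IsCubeRootPair (b ^ 2 + 4 * a) m t)
    (z : QuadraticAlgebra ℚ a b) :
    z ∈ latticeIdeal a b m t ↔ ∃ p q : ℤ, z = p * m + q * latticeGen a b m t := by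
  obtain ⟨hm, -, k, hk⟩ := h
  obtain ⟨r, hr⟩ := omega_eq_latticeGen hm.ne' hk
  have hsq := latticeGen_sq hm.ne' hk
  have hz (w : QuadraticAlgebra ℤ a b) : (⟨w.re, w.im⟩ : QuadraticAlgebra ℚ a b) =
      w.re + w.im * ⟨0, 1⟩ := by ext <;> simp
  simp only [latticeIdeal, FractionalIdeal.mem_add, FractionalIdeal.mem_spanSingleton]
  set α := latticeGen a b m t
  constructor
  · rintro ⟨_, ⟨x, rfl⟩, _, ⟨y, rfl⟩, rfl⟩
    rw [smul_intRat, smul_intRat, hz, hz, hr]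
    refine ⟨x.re + x.im * r - y.im * (t ^ 2 - m * k),
      x.im * m ^ 2 + y.re + y.im * r + y.im * m * t, ?_⟩
    push_cast at hsq ⊢
    linear_combination (y.im * m : QuadraticAlgebra ℚ a b) * hsq
  · rintro ⟨p, q, rfl⟩
    refine ⟨_, ⟨(p : QuadraticAlgebra ℤ a b), rfl⟩, _, ⟨(q : QuadraticAlgebra ℤ a b), rfl⟩, ?_⟩
    simp only [smul_intRat, hz]
    simp

theorem intCast_mem_one (n : ℤ) : (n : QuadraticAlgebra ℚ a b) ∈
    (1 : FractionalIdeal (QuadraticAlgebra ℤ a b)⁰ (QuadraticAlgebra ℚ a b)) :=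
  (FractionalIdeal.mem_one_iff _).2 ⟨n, by simp⟩

theorem latticeIdeal_pow_three {m t : ℤ} (h : IsCubeRootPair (b ^ 2 + 4 * a) m t) :
    latticeIdeal a b m t ^ 3 = 1 := by
  have hmem := h
  obtain ⟨hm, hcop, k, hk⟩ := h
  obtain ⟨r, hr⟩ := omega_eq_latticeGen hm.ne' hk
  have hsq := latticeGen_sq hm.ne' hk
  have hone (c d : ℤ) : (c + d * (m * latticeGen a b m t) : QuadraticAlgebra ℚ a b) ∈
      (1 : FractionalIdeal (QuadraticAlgebra ℤ a b)⁰ (QuadraticAlgebra ℚ a b)) := by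
    rw [mem_one_iff_coord]
    refine ⟨c - d * r, d, ?_⟩
    rw [← sub_eq_iff_eq_add'.2 hr]
    ext <;> simp [sub_eq_add_neg]
  have hexp : latticeIdeal a b m t ^ 3 =
      FractionalIdeal.spanSingleton _ ((m : QuadraticAlgebra ℚ a b) ^ 3) +
      3 * FractionalIdeal.spanSingleton _ ((m : QuadraticAlgebra ℚ a b) ^ 2 * latticeGen a b m t) +
      3 * FractionalIdeal.spanSingleton _ ((m : QuadraticAlgebra ℚ a b) * latticeGen a b m t ^ 2) +
      FractionalIdeal.spanSingleton _ (latticeGen a b m t ^ 3) := by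
    simp only [latticeIdeal, ← FractionalIdeal.spanSingleton_mul_spanSingleton,
      ← FractionalIdeal.spanSingleton_pow]
    ring
  set α := latticeGen a b m t
  have hthree (J : FractionalIdeal (QuadraticAlgebra ℤ a b)⁰ (QuadraticAlgebra ℚ a b)) :
      3 * J ≤ J := by
    have : (3 : FractionalIdeal (QuadraticAlgebra ℤ a b)⁰ (QuadraticAlgebra ℚ a b)) =
        1 + 1 + 1 := by
      norm_num
    rw [this, add_mul, add_mul, one_mul]
    exact sup_le (sup_le le_rfl le_rfl) le_rfl
  -- `α³ = mkα - tN` with `N = t² - mk` the norm of `α`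
  have hcube : α ^ 3 = ((-t * (t ^ 2 - m * k) : ℤ) : QuadraticAlgebra ℚ a b) +
      (k : ℤ) * (m * α) := by
    push_cast at hsq ⊢
    linear_combination (α + t) * hsq
  refine le_antisymm ?_ ?_
  · rw [hexp]
    refine sup_le (sup_le (sup_le ?_ ((hthree _).trans ?_)) ((hthree _).trans ?_)) ?_ <;>
      rw [FractionalIdeal.spanSingleton_le_iff_mem]
    · convert hone (m ^ 3) 0 using 1
      push_cast
      ring
    · convert hone 0 m using 1
      push_cast
      ring
    · convert hone (-m * (t ^ 2 - m * k)) t using 1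
      push_cast at hsq ⊢
      linear_combination (m : QuadraticAlgebra ℚ a b) * hsq
    · rw [hcube]
      exact hone _ _
  · -- the cube contains `m³` and the norm of `α³`, which are coprime
    have hmm : (m : QuadraticAlgebra ℚ a b) ∈ latticeIdeal a b m t :=
      (mem_latticeIdeal hmem _).2 ⟨1, 0, by simp⟩
    have hα : α ∈ latticeIdeal a b m t := (mem_latticeIdeal hmem _).2 ⟨0, 1, by simp [α]⟩
    have hpow {x : QuadraticAlgebra ℚ a b} (hx : x ∈ latticeIdeal a b m t) :
        x ^ 3 ∈ latticeIdeal a b m t ^ 3 := by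
      rw [pow_succ, pow_two, pow_succ, pow_two]
      exact FractionalIdeal.mul_mem_mul (FractionalIdeal.mul_mem_mul hx hx) hx
    have hN : (((t ^ 2 - m * k) ^ 3 : ℤ) : QuadraticAlgebra ℚ a b) ∈ latticeIdeal a b m t ^ 3 := by
      -- `t³ - 2tN - mkα` is the conjugate of `α³`
      have h1 := FractionalIdeal.mul_mem_mul (hone (t ^ 3 - t * (t ^ 2 - m * k) * 2) (-k)) (hpow hα)
      rw [one_mul] at h1
      convert h1 using 1
      rw [hcube]
      push_cast at hsq ⊢
      linear_combination (k * m * k * m : QuadraticAlgebra ℚ a b) * hsq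
    have hm3 : ((m ^ 3 : ℤ) : QuadraticAlgebra ℚ a b) ∈ latticeIdeal a b m t ^ 3 := by
      simpa using hpow hmm
    have hcop' : IsCoprime (m ^ 3) ((t ^ 2 - m * k) ^ 3) := by
      refine IsCoprime.pow ?_
      have : IsCoprime m (t ^ 2) := hcop.pow_right
      simpa [sub_eq_add_neg] using this.add_mul_left_right (-k)
    obtain ⟨u, v, huv⟩ := hcop'
    rw [FractionalIdeal.one_le]
    have h1 := FractionalIdeal.mul_mem_mul (intCast_mem_one u) hm3
    have h2 := FractionalIdeal.mul_mem_mul (intCast_mem_one v) hN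
    rw [one_mul] at h1 h2
    have h3 := add_mem (S := Submodule _ _) h1 h2
    rw [← Int.cast_mul, ← Int.cast_mul, ← Int.cast_add, huv, Int.cast_one] at h3
    exact h3

/-- The lattice determines `m`, which generates its intersection with `ℚ`, and `t` modulo `2m`. -/
theorem latticeIdeal_inj {m t m' t' : ℤ} (h : IsCubeRootPair (b ^ 2 + 4 * a) m t)
    (h' : IsCubeRootPair (b ^ 2 + 4 * a) m' t')
    (heq : latticeIdeal a b m t = latticeIdeal a b m' t') : m = m' ∧ 2 * m ∣ t - t' := by
  have key {m t m' t' : ℤ} (h : IsCubeRootPair (b ^ 2 + 4 * a) m t)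
    (h' : IsCubeRootPair (b ^ 2 + 4 * a) m' t')
    (heq : latticeIdeal a b m t = latticeIdeal a b m' t') : m' ∣ m := by
    have h1 : (m : QuadraticAlgebra ℚ a b) ∈ latticeIdeal a b m' t' :=
      heq ▸ (mem_latticeIdeal h _).2 ⟨1, 0, by simp⟩
    obtain ⟨p, q, hpq⟩ := (mem_latticeIdeal h' _).1 h1
    have him := congrArg im hpq
    have hre := congrArg re hpq
    have hm' : (m' : ℚ) ≠ 0 := by exact_mod_cast h'.pos.ne'
    simp [latticeGen, hm'] at him
    simp [him] at hre
    exact ⟨p, by rw [mul_comm]; exact_mod_cast hre⟩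
  have hmm : m = m' := Int.dvd_antisymm h.pos.le h'.pos.le (key h' h heq.symm) (key h h' heq)
  subst hmm
  refine ⟨rfl, ?_⟩
  have h1 : latticeGen a b m t ∈ latticeIdeal a b m t' :=
    heq ▸ (mem_latticeIdeal h _).2 ⟨0, 1, by simp⟩
  obtain ⟨p, q, hpq⟩ := (mem_latticeIdeal h' _).1 h1
  have him := congrArg im hpq
  have hre := congrArg re hpq
  have hm' : (m : ℚ) ≠ 0 := by exact_mod_cast h.pos.ne'
  simp [latticeGen, hm'] at him
  have hq : (q : ℚ) = 1 := by exact_mod_cast him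
  simp [latticeGen, hq] at hre
  refine ⟨p, ?_⟩
  have : (t - t' : ℚ) = 2 * m * p := by linear_combination 2 * hre
  exact_mod_cast this

theorem latticeIdeal_congr {m t t' : ℤ} (h : IsCubeRootPair (b ^ 2 + 4 * a) m t)
    (h' : IsCubeRootPair (b ^ 2 + 4 * a) m t') (ht : 2 * m ∣ t - t') :
    latticeIdeal a b m t = latticeIdeal a b m t' := by
  obtain ⟨p, hp⟩ := ht
  have hα : latticeGen a b m t = latticeGen a b m t' + p * m := by
    have hp' : (t - t' : ℚ) = 2 * m * p := by exact_mod_cast hp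
    ext
    · simp [latticeGen]
      linear_combination hp' / 2
    · simp [latticeGen]
  ext z
  rw [mem_latticeIdeal h, mem_latticeIdeal h']
  constructor
  · rintro ⟨x, y, rfl⟩
    refine ⟨x + y * p, y, ?_⟩
    rw [hα]
    push_cast
    ring
  · rintro ⟨x, y, rfl⟩
    refine ⟨x - y * p, y, ?_⟩
    rw [hα]
    push_cast
    ring

end QuadraticOrder

/-! ### Every cube root is given by a pair -/

namespace QuadraticOrder
open QuadraticAlgebra
variable {a b : ℤ}

theorem mul_mul_mem_pow_three
    {I : FractionalIdeal (QuadraticAlgebra ℤ a b)⁰ (QuadraticAlgebra ℚ a b)}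
    {x y z : QuadraticAlgebra ℚ a b} (hx : x ∈ I) (hy : y ∈ I) (hz : z ∈ I) :
    x * y * z ∈ I ^ 3 := by
  rw [pow_succ, pow_two]
  exact FractionalIdeal.mul_mem_mul (FractionalIdeal.mul_mem_mul hx hy) hz

variable [Fact (∀ r : ℚ, r ^ 2 ≠ a + b * r)]

/-- The rational numbers in a cube root of the order are integers, so they are the multiples of
some `m > 0`. -/
theorem exists_generator_rat
    {I : FractionalIdeal (QuadraticAlgebra ℤ a b)⁰ (QuadraticAlgebra ℚ a b)} (hI : I ^ 3 = 1) :
    ∃ m : ℤ, 0 < m ∧ ∀ r : ℚ, (⟨r, 0⟩ : QuadraticAlgebra ℚ a b) ∈ I ↔ ∃ p : ℤ, r = p * m := by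
  have hint (r : ℚ) (hr : (⟨r, 0⟩ : QuadraticAlgebra ℚ a b) ∈ I) : ∃ n : ℤ, r = n := by
    have h3 := mul_mul_mem_pow_three hr hr hr
    rw [hI, mem_one_iff_coord] at h3
    obtain ⟨p, q, hpq⟩ := h3
    have := congrArg re hpq
    simp at this
    exact Rat.exists_int_of_cubic (u := 0) (v := p) (by simp [← this]; ring)
  let A : AddSubgroup ℤ :=
    { carrier := {n : ℤ | (⟨n, 0⟩ : QuadraticAlgebra ℚ a b) ∈ I}
      zero_mem' := by
        have := zero_mem (I : Submodule (QuadraticAlgebra ℤ a b) (QuadraticAlgebra ℚ a b))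
        change _ ∈ (I : Submodule (QuadraticAlgebra ℤ a b) (QuadraticAlgebra ℚ a b))
        convert this using 1
        ext <;> simp
      add_mem' := fun {x y} hx hy => by
        have := add_mem (S := Submodule _ _) hx hy
        change _ ∈ (I : Submodule (QuadraticAlgebra ℤ a b) (QuadraticAlgebra ℚ a b))
        convert this using 1
        ext <;> simp
      neg_mem' := fun {x} hx => by
        have := neg_mem (S := Submodule _ _) hx
        change _ ∈ (I : Submodule (QuadraticAlgebra ℤ a b) (QuadraticAlgebra ℚ a b))
        convert this using 1
        ext <;> simp }
  obtain ⟨m, hm⟩ := Int.subgroup_cyclic A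
  have hmem (n : ℤ) : (⟨n, 0⟩ : QuadraticAlgebra ℚ a b) ∈ I ↔ m ∣ n := by
    change n ∈ A ↔ _
    rw [hm, AddSubgroup.mem_closure_singleton]
    constructor
    · rintro ⟨k, rfl⟩
      exact ⟨k, by simp [mul_comm]⟩
    · rintro ⟨k, rfl⟩
      exact ⟨k, by simp [mul_comm]⟩
  have hm0 : m ≠ 0 := by
    rintro rfl
    have hI0 : I ≠ 0 := by
      rintro rfl
      simp at hI
    obtain ⟨z, hz, hz0⟩ : ∃ z ∈ I, z ≠ 0 := by
      by_contra! h
      exact hI0 (FractionalIdeal.eq_zero_iff.2 h)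
    obtain ⟨⟨w, s⟩, hw⟩ := IsLocalization.surj (QuadraticAlgebra ℤ a b)⁰ z
    have hw0 : w ≠ 0 := by
      rintro rfl
      simp [hz0] at hw
    have h1 : (star w * s) • z ∈ I := Submodule.smul_mem I.1 _ hz
    rw [mul_smul, Algebra.smul_def (s : QuadraticAlgebra ℤ a b), mul_comm _ z, hw,
      Algebra.smul_def, ← map_mul, mul_comm, ← algebraMap_norm_eq_mul_star] at h1
    have h2 := (hmem (norm w)).1 h1
    rw [zero_dvd_iff] at h2
    have h3 : w * star w = 0 := by rw [← algebraMap_norm_eq_mul_star, h2, map_zero]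
    rcases mul_eq_zero.1 h3 with h | h
    · exact hw0 h
    · exact hw0 (star_eq_zero.1 h)
  refine ⟨|m|, abs_pos.2 hm0, fun r => ⟨fun hr => ?_, ?_⟩⟩
  · obtain ⟨n, rfl⟩ := hint r hr
    obtain ⟨k, hk⟩ := (abs_dvd m n).2 ((hmem n).1 hr)
    exact ⟨k, by rw [hk]; push_cast; ring⟩
  · rintro ⟨p, rfl⟩
    have := (hmem (p * |m|)).2 ((dvd_abs m m).2 dvd_rfl |>.mul_left _)
    exact_mod_cast this

/-- The coordinates at `ω` of the elements of a fractional ideal are multiples of the coordinate of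
one of them. -/
theorem exists_generator_im
    {I : FractionalIdeal (QuadraticAlgebra ℤ a b)⁰ (QuadraticAlgebra ℚ a b)} {m : ℤ} (hm : 0 < m)
    (hmI : (m : QuadraticAlgebra ℚ a b) ∈ I) :
    ∃ α ∈ I, 0 < α.im ∧ ∀ z ∈ I, ∃ q : ℤ, z.im = q * α.im := by
  obtain ⟨s, hs, hsI⟩ := I.isFractional
  -- a common denominator `n` of the lattice
  obtain ⟨n, hn0, hn⟩ : ∃ n : ℤ, n ≠ 0 ∧ ∀ z ∈ I, ∃ k : ℤ, n * z.im = k := by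
    have hs0 := nonZeroDivisors.ne_zero hs
    refine ⟨norm s, ?_, fun z hz => ?_⟩
    · intro h2
      have h3 : s * star s = 0 := by rw [← algebraMap_norm_eq_mul_star, h2, map_zero]
      rcases mul_eq_zero.1 h3 with h | h
      · exact hs0 h
      · exact hs0 (star_eq_zero.1 h)
    · obtain ⟨w, hw⟩ := hsI z hz
      have h1 : (algebraMap ℤ _ (norm s) : QuadraticAlgebra ℤ a b) • z =
          algebraMap _ (QuadraticAlgebra ℚ a b) (star s * w) := by
        rw [algebraMap_norm_eq_mul_star, mul_comm, mul_smul, map_mul, hw, Algebra.smul_def]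
      have := congrArg im h1
      rw [algebraMap_intRat, smul_intRat] at this
      exact ⟨(star s * w).im, by simpa using this⟩
  let B : AddSubgroup ℤ :=
    { carrier := {k : ℤ | ∃ z ∈ I, n * z.im = k}
      zero_mem' := ⟨0, zero_mem (S := Submodule _ _) I.1, by simp⟩
      add_mem' := by
        rintro x y ⟨z, hz, hx⟩ ⟨w, hw, hy⟩
        exact ⟨z + w, add_mem (S := Submodule _ _) hz hw, by simp [mul_add, hx, hy]⟩
      neg_mem' := by
        rintro x ⟨z, hz, hx⟩
        exact ⟨-z, neg_mem (S := Submodule _ _) hz, by simp [hx]⟩ }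
  obtain ⟨g, hg⟩ := Int.subgroup_cyclic B
  have hgB : g ∈ B := by rw [hg]; exact AddSubgroup.mem_closure_singleton_self g
  obtain ⟨α, hα, hαg⟩ := hgB
  have hn0' : (n : ℚ) ≠ 0 := by exact_mod_cast hn0
  have hdvd (z) (hz : z ∈ I) : ∃ q : ℤ, z.im = q * α.im := by
    obtain ⟨k, hk⟩ := hn z hz
    have hkB : k ∈ B := ⟨z, hz, hk⟩
    rw [hg, AddSubgroup.mem_closure_singleton] at hkB
    obtain ⟨q, hq⟩ := hkB
    refine ⟨q, mul_left_cancel₀ hn0' ?_⟩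
    rw [hk, ← hq]
    push_cast [smul_eq_mul]
    linear_combination -(q : ℚ) * hαg
  have h0 : α.im ≠ 0 := by
    intro h0
    have hω : (⟨0, 1⟩ : QuadraticAlgebra ℤ a b) • (m : QuadraticAlgebra ℚ a b) ∈ I :=
      Submodule.smul_mem I.1 _ hmI
    obtain ⟨q, hq⟩ := hdvd _ hω
    rw [smul_intRat, h0] at hq
    simp at hq
    omega
  rcases h0.lt_or_gt with h | h
  · refine ⟨-α, neg_mem (S := Submodule _ _) hα, by simpa using h, fun z hz => ?_⟩
    obtain ⟨q, hq⟩ := hdvd z hz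
    exact ⟨-q, by simp [hq]⟩
  · exact ⟨α, hα, h, hdvd⟩

/-- The trace and norm of an element whose cube lies in the order are integers. -/
theorem exists_int_trace_norm {α : QuadraticAlgebra ℚ a b}
    (h : α ^ 3 ∈ (1 : FractionalIdeal (QuadraticAlgebra ℤ a b)⁰ (QuadraticAlgebra ℚ a b))) :
    ∃ t N : ℤ, trace α = t ∧ norm α = N := by
  obtain ⟨x, y, hxy⟩ := (mem_one_iff_coord _).1 h
  have h1 : norm α ^ 3 = ((x * x + b * x * y - a * y * y : ℤ) : ℚ) := by
    rw [← map_pow, hxy, norm_def]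
    push_cast
    ring
  obtain ⟨N, hN⟩ := Rat.exists_int_of_cubic (u := 0)
    (v := x * x + b * x * y - a * y * y) (by rw [h1]; simp)
  have hre : (α ^ 3).re = x := congrArg re hxy
  have him : (α ^ 3).im = y := congrArg im hxy
  have h2 : trace α ^ 3 = (3 * N : ℤ) * trace α + (2 * x + b * y : ℤ) := by
    push_cast
    rw [← hN, ← hre, ← him, trace_def, norm_def, pow_succ α, pow_two]
    simp
    ring
  obtain ⟨t, ht⟩ := Rat.exists_int_of_cubic h2
  exact ⟨t, N, ht, hN⟩

/-- Every fractional ideal with cube `1` is one of the lattices `latticeIdeal a b m t`. -/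
theorem exists_eq_latticeIdeal
    {I : FractionalIdeal (QuadraticAlgebra ℤ a b)⁰ (QuadraticAlgebra ℚ a b)} (hI : I ^ 3 = 1) :
    ∃ m t : ℤ, IsCubeRootPair (b ^ 2 + 4 * a) m t ∧ I = latticeIdeal a b m t := by
  obtain ⟨m, hm, hmI⟩ := exists_generator_rat hI
  have hmem : (m : QuadraticAlgebra ℚ a b) ∈ I := (hmI m).2 ⟨1, by simp⟩
  obtain ⟨α, hα, hpos, hdvd⟩ := exists_generator_im hm hmem
  have hcube : α ^ 3 ∈
      (1 : FractionalIdeal (QuadraticAlgebra ℤ a b)⁰ (QuadraticAlgebra ℚ a b)) := by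
    rw [← hI, pow_succ α, pow_two]
    exact mul_mul_mem_pow_three hα hα hα
  obtain ⟨t, N, ht, hN⟩ := exists_int_trace_norm hcube
  have hsq : α * α = t * α - N := by
    have := sq_eq_trace_smul_sub_norm α
    rw [ht, hN, Algebra.smul_def] at this
    simpa [pow_two] using this
  have hbasis (z) : z ∈ I ↔ ∃ p q : ℤ, z = p * m + q * α := by
    constructor
    · intro hz
      obtain ⟨q, hq⟩ := hdvd z hz
      have h1 : z - (q : QuadraticAlgebra ℤ a b) • α ∈ I :=
        sub_mem (S := Submodule _ _) hz (Submodule.smul_mem I.1 _ hα)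
      have h2 : z - (q : QuadraticAlgebra ℤ a b) • α = ⟨z.re - q * α.re, 0⟩ := by
        ext <;> simp [smul_intRat, hq]
      rw [h2, hmI] at h1
      obtain ⟨p, hp⟩ := h1
      refine ⟨p, q, ?_⟩
      ext
      · simp; linear_combination hp
      · simp [hq]
    · rintro ⟨p, q, rfl⟩
      have := add_mem (S := Submodule _ _)
        (Submodule.smul_mem I.1 (p : QuadraticAlgebra ℤ a b) hmem)
        (Submodule.smul_mem I.1 (q : QuadraticAlgebra ℤ a b) hα)
      simpa [Algebra.smul_def] using this
  have hindep {c d c' d' : ℤ} (h : (c + d * α : QuadraticAlgebra ℚ a b) = c' + d' * α) :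
      c = c' ∧ d = d' := by
    have him := congrArg im h
    have hre := congrArg re h
    simp [hpos.ne'] at him
    simp [him] at hre
    exact ⟨hre, him⟩
  -- a common divisor `e` of `m` and `t N` divides the `1`-coordinate of every element of `I ^ 3`
  have hspan (z) (hz : z ∈ I ^ 3) (e : ℤ) (hem : e ∣ m) (heN : e ∣ t * N) :
      ∃ c d : ℤ, z = (e * c : ℤ) + d * α := by
    obtain ⟨m', rfl⟩ := hem
    obtain ⟨N', hN'⟩ := heN
    have hN'' : (t * N : QuadraticAlgebra ℚ a b) = e * N' := by exact_mod_cast hN'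
    rw [pow_succ, pow_two] at hz
    have h2 (y) (hy : y ∈ I * I) : ∃ c d f : ℤ, y = (e * c : ℤ) + (e * d : ℤ) * α + f * α ^ 2 := by
      refine FractionalIdeal.mul_induction_on hy (fun i hi j hj => ?_) ?_
      · obtain ⟨p, q, rfl⟩ := (hbasis i).1 hi
        obtain ⟨p', q', rfl⟩ := (hbasis j).1 hj
        refine ⟨p * p' * m' * (e * m'), m' * (p * q' + p' * q), q * q', ?_⟩
        push_cast
        ring
      · rintro _ _ ⟨c, d, f, rfl⟩ ⟨c', d', f', rfl⟩
        refine ⟨c + c', d + d', f + f', ?_⟩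
        push_cast
        ring
    refine FractionalIdeal.mul_induction_on hz (fun i hi j hj => ?_) ?_
    · obtain ⟨c, d, f, rfl⟩ := h2 i hi
      obtain ⟨p, q, rfl⟩ := (hbasis j).1 hj
      refine ⟨c * p * (e * m') - (d * q + f * p * m') * N - f * q * N',
        e * c * q + e * d * p * (e * m') + (e * d * q + f * p * (e * m')) * t +
          f * q * (t ^ 2 - N), ?_⟩
      push_cast
      linear_combination (e * d * q + f * p * e * m' + f * q * α + f * q * t :
        QuadraticAlgebra ℚ a b) * hsq - (f * q : QuadraticAlgebra ℚ a b) * hN''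
    · rintro _ _ ⟨c, d, rfl⟩ ⟨c', d', rfl⟩
      refine ⟨c + c', d + d', ?_⟩
      push_cast
      ring
  -- apply this to `1` and to `ω`
  have hcop : IsCoprime m (t * N) := by
    rw [Int.isCoprime_iff_gcd_eq_one]
    obtain ⟨c, d, hcd⟩ := hspan 1 (by rw [hI]; exact FractionalIdeal.one_mem_one _) _
      (Int.gcd_dvd_left (a := m) (b := t * N)) (Int.gcd_dvd_right (a := m) (b := t * N))
    have := (hindep (c := 1) (d := 0) (c' := Int.gcd m (t * N) * c) (d' := d)
      (by simpa using hcd)).1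
    have h1 : ((Int.gcd m (t * N) : ℕ) : ℤ) ∣ 1 := ⟨c, this⟩
    exact Nat.dvd_one.1 (by exact_mod_cast h1)
  obtain ⟨c, d, hω⟩ : ∃ c d : ℤ, (⟨0, 1⟩ : QuadraticAlgebra ℚ a b) = c + d * α := by
    have h1 : (⟨0, 1⟩ : QuadraticAlgebra ℚ a b) ∈ I ^ 3 := by
      rw [hI, mem_one_iff_coord]
      exact ⟨0, 1, by simp⟩
    simpa using hspan _ h1 1 (one_dvd _) (one_dvd _)
  have hd : d * α.im = 1 := by simpa using (congrArg im hω).symm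
  have hdpos : 0 < d := by
    have : (0 : ℚ) < d := pos_of_mul_pos_left (by rw [hd]; exact one_pos) hpos.le
    exact_mod_cast this
  have hone {x y : ℤ} (h : (x + y * α : QuadraticAlgebra ℚ a b) ∈ I ^ 3) : d ∣ y := by
    rw [hI, mem_one_iff_coord] at h
    obtain ⟨p, q, hpq⟩ := h
    have him := congrArg im hpq
    simp at him
    refine ⟨q, ?_⟩
    have : (y : ℚ) = d * q := by linear_combination d * him - y * hd
    exact_mod_cast this
  have hcop1 : IsCoprime m t := IsCoprime.of_mul_right_left hcop
  have hcop2 : IsCoprime m N := IsCoprime.of_mul_right_right hcop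
  -- the `α`-coordinates of the elements `m²α`, `mα²`, `α³` of the order
  have hd1 : d ∣ m ^ 2 := hone (x := 0) (by
    convert mul_mul_mem_pow_three hmem hmem hα using 1
    push_cast; ring)
  have hd2 : d ∣ m * t := hone (x := -m * N) (by
    convert mul_mul_mem_pow_three hmem hα hα using 1
    rw [mul_assoc, hsq]
    push_cast; ring)
  have hd3 : d ∣ t ^ 2 - N := hone (x := -t * N) (by
    convert mul_mul_mem_pow_three hα hα hα using 1
    push_cast
    linear_combination -(α + t) * hsq)
  have hdm : d ∣ m := by
    obtain ⟨u, v, huv⟩ := hcop1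
    have : m = u * m ^ 2 + v * (m * t) := by linear_combination -m * huv
    rw [this]
    exact dvd_add (hd1.mul_left _) (hd2.mul_left _)
  -- the rational part of `ωα`, an element of `I`, is `-dN` modulo `ℤα`
  have hmd : m ∣ d := by
    have h1 : (⟨0, 1⟩ : QuadraticAlgebra ℤ a b) • α ∈ I := Submodule.smul_mem I.1 _ hα
    rw [hbasis] at h1
    obtain ⟨p, q, hpq⟩ := h1
    have h2 : ((-d * N : ℤ) + (c + d * t : ℤ) * α : QuadraticAlgebra ℚ a b) =
        (p * m : ℤ) + q * α := by
      push_cast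
      rw [← hpq, smul_intRat]
      have : (⟨((⟨0, 1⟩ : QuadraticAlgebra ℤ a b).re : ℚ),
          ((⟨0, 1⟩ : QuadraticAlgebra ℤ a b).im : ℚ)⟩ : QuadraticAlgebra ℚ a b) = ⟨0, 1⟩ := by simp
      rw [this, hω]
      linear_combination -(d : QuadraticAlgebra ℚ a b) * hsq
    refine hcop2.dvd_of_dvd_mul_right (z := N) (y := d) ?_
    exact ⟨-p, by linear_combination -(hindep h2).1⟩
  obtain rfl : d = m := Int.dvd_antisymm hdpos.le hm.le hdm hmd
  have hd0 : (d : ℚ) ≠ 0 := by exact_mod_cast hm.ne'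
  have him : α.im = 1 / d := by rw [eq_div_iff hd0, mul_comm, hd]
  have hre : α.re = (t - b / d) / 2 := by
    rw [trace_def, him] at ht
    field_simp at ht ⊢
    linear_combination ht
  have hαeq : α = latticeGen a b d t := QuadraticAlgebra.ext hre him
  have hpair : IsCubeRootPair (b ^ 2 + 4 * a) d t := by
    refine ⟨hm, hcop1, ?_⟩
    obtain ⟨k, hk⟩ := hd3
    refine ⟨k, ?_⟩
    have h1 : (t ^ 2 - N : ℚ) = d * k := by exact_mod_cast hk
    rw [norm_def, him, hre] at hN
    have : (b ^ 2 + 4 * a + 3 * d ^ 2 * t ^ 2 : ℚ) = 4 * d ^ 3 * k := by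
      field_simp at hN
      linear_combination 4 * (d : ℚ) ^ 2 * h1 - hN
    exact_mod_cast this
  refine ⟨d, t, hpair, ?_⟩
  ext z
  rw [hbasis, mem_latticeIdeal hpair, hαeq]

end QuadraticOrder

/-! ### The number of cube roots of an order -/

namespace QuadraticOrder
open QuadraticAlgebra

open Classical in
/-- The number of `t` modulo `2m` for which `(m, t)` gives a cube root of the order of
discriminant `D`. -/
noncomputable def rootCount (D : ℤ) (m : ℕ) : ℕ :=
  ((Finset.range (2 * m)).filter fun t : ℕ => IsCubeRootPair D m t).card

theorem IsCubeRootPair.sq_dvd {D m t : ℤ} (h : IsCubeRootPair D m t) : m ^ 2 ∣ D := by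
  have h1 : m ^ 2 ∣ D + m ^ 2 * (3 * t ^ 2) := by
    have := (Dvd.intro_left (4 * m) (by ring : 4 * m * m ^ 2 = 4 * m ^ 3)).trans h.dvd
    rwa [mul_comm 3, mul_assoc] at this
  exact (Int.dvd_add_left (Dvd.intro _ rfl)).1 h1

theorem IsCubeRootPair.emod {D m t : ℤ} (h : IsCubeRootPair D m t) :
    IsCubeRootPair D m (t % (2 * m)) := by
  obtain ⟨hm, hc, k, hk⟩ := h
  have ht := Int.emod_add_mul_ediv t (2 * m)
  obtain ⟨s, hs⟩ : ∃ s, s = t % (2 * m) := ⟨_, rfl⟩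
  obtain ⟨q, hq⟩ : ∃ s, s = t / (2 * m) := ⟨_, rfl⟩
  rw [← hs, ← hq] at ht
  rw [← hs]
  obtain rfl : s = t + m * (-2 * q) := by linear_combination ht
  refine ⟨hm, hc.add_mul_left_right _, k - 3 * t * q + 3 * m * q ^ 2, ?_⟩
  linear_combination hk

theorem rootCount_eq_zero_of_lt {D : ℤ} (hD : D ≠ 0) {m : ℕ} (h : D.natAbs < m) :
    rootCount D m = 0 := by
  classical
  rw [rootCount, Finset.card_eq_zero, Finset.filter_eq_empty_iff]
  intro t _ ht
  have h1 : (m : ℤ) ∣ D := (Dvd.intro_left _ (by ring)).trans ht.sq_dvd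
  exact absurd (Nat.le_of_dvd (Int.natAbs_pos.2 hD) (Int.natCast_dvd.1 h1)) (by omega)

section model

variable {a b : ℤ} [Fact (∀ r : ℚ, r ^ 2 ≠ a + b * r)]

/-- The unit of the semiring of fractional ideals given by a pair `(m, t)`. -/
noncomputable def latticeUnit {m t : ℤ} (h : IsCubeRootPair (b ^ 2 + 4 * a) m t) :
    (FractionalIdeal (QuadraticAlgebra ℤ a b)⁰ (QuadraticAlgebra ℚ a b))ˣ :=
  Units.ofPowEqOne _ 3 (latticeIdeal_pow_three h) (by norm_num)

open Classical in
/-- The ideals with cube `1` correspond to the pairs `(m, t mod 2m)`. -/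
theorem bijective_cubeRoots (hD : b ^ 2 + 4 * a ≠ 0) : ∃ f :
    ((Finset.range ((b ^ 2 + 4 * a).natAbs + 1)).sigma fun m =>
      (Finset.range (2 * m)).filter fun t : ℕ => IsCubeRootPair (b ^ 2 + 4 * a) m t) →
    {I : (FractionalIdeal (QuadraticAlgebra ℤ a b)⁰ (QuadraticAlgebra ℚ a b))ˣ // I ^ 3 = 1},
    Function.Bijective f := by
  have hS (p : ((Finset.range ((b ^ 2 + 4 * a).natAbs + 1)).sigma fun m =>
      (Finset.range (2 * m)).filter fun t : ℕ => IsCubeRootPair (b ^ 2 + 4 * a) m t)) :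
      IsCubeRootPair (b ^ 2 + 4 * a) p.1.1 p.1.2 :=
    (Finset.mem_filter.1 (Finset.mem_sigma.1 p.2).2).2
  refine ⟨fun p => ⟨latticeUnit (hS p), ?_⟩, ?_, ?_⟩
  · ext1
    rw [Units.val_pow_eq_pow_val]
    exact latticeIdeal_pow_three (hS p)
  · intro p q hpq
    have h1 : latticeIdeal a b p.1.1 p.1.2 = latticeIdeal a b q.1.1 q.1.2 :=
      congrArg (fun I => I.1.1) hpq
    obtain ⟨h2, h3⟩ := latticeIdeal_inj (hS p) (hS q) h1
    have hp := Finset.mem_range.1 (Finset.mem_filter.1 (Finset.mem_sigma.1 p.2).2).1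
    have hq := Finset.mem_range.1 (Finset.mem_filter.1 (Finset.mem_sigma.1 q.2).2).1
    obtain ⟨⟨m, t⟩, _⟩ := p
    obtain ⟨⟨m', t'⟩, _⟩ := q
    simp only [Nat.cast_inj] at h2 h3 hp hq
    subst h2
    have h4 := Int.eq_zero_of_abs_lt_dvd h3 (by rw [abs_lt]; omega)
    simp only [Subtype.mk.injEq, Sigma.mk.injEq, heq_eq_eq, true_and]
    omega
  · rintro ⟨I, hI⟩
    have hI' :
        (I : FractionalIdeal (QuadraticAlgebra ℤ a b)⁰ (QuadraticAlgebra ℚ a b)) ^ 3 = 1 := by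
      rw [← Units.val_pow_eq_pow_val, hI, Units.val_one]
    obtain ⟨m, t, h, hIm⟩ := exists_eq_latticeIdeal hI'
    have h2 := h.emod
    have hm := h.pos
    have h3 := Int.emod_nonneg t (b := 2 * m) (by omega)
    have h4 := Int.emod_lt_of_pos t (b := 2 * m) (by omega)
    have h5 : 2 * m ∣ t - t % (2 * m) := Int.dvd_self_sub_emod
    rw [latticeIdeal_congr h h2 h5] at hIm
    generalize t % (2 * m) = s at h2 h3 h4 hIm
    lift m to ℕ using hm.le
    lift s to ℕ using h3
    refine ⟨⟨⟨m, s⟩, Finset.mem_sigma.2 ⟨?_, Finset.mem_filter.2 ⟨?_, h2⟩⟩⟩, ?_⟩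
    · rw [Finset.mem_range]
      have h1 : (m : ℤ) ∣ b ^ 2 + 4 * a := (Dvd.intro_left _ (by ring)).trans h2.sq_dvd
      have := Nat.le_of_dvd (Int.natAbs_pos.2 hD) (Int.natCast_dvd.1 h1)
      change m < _
      omega
    · rw [Finset.mem_range]
      change s < 2 * m
      omega
    · ext1
      ext1
      exact hIm.symm

/-- The order `ℤ[ω]`, where `ω² = a + bω`. -/
noncomputable def model (a b : ℤ) [Fact (∀ r : ℚ, r ^ 2 ≠ a + b * r)] : QuadraticOrder where
  carrier := QuadraticAlgebra ℤ a b
  finrank_eq_two := QuadraticAlgebra.finrank_eq_two a b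

theorem model_discr : (model a b).discr = b ^ 2 + 4 * a := by
  have htr (z : QuadraticAlgebra ℤ a b) : Algebra.trace ℤ (QuadraticAlgebra ℤ a b) z =
      2 * z.re + b * z.im := by
    rw [Algebra.trace_eq_matrix_trace (QuadraticAlgebra.basis a b), Matrix.trace_fin_two,
      Algebra.leftMulMatrix_eq_repr_mul, Algebra.leftMulMatrix_eq_repr_mul]
    simp [QuadraticAlgebra.basis]
    ring
  have h := discr_eq (model a b) (QuadraticAlgebra.basis a b)
  refine h.trans ?_
  change Algebra.discr ℤ (QuadraticAlgebra.basis a b) = _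
  rw [Algebra.discr_def, Matrix.det_fin_two]
  simp only [Algebra.traceMatrix_apply, Algebra.traceForm_apply, htr]
  simp [QuadraticAlgebra.basis]
  ring

theorem finite_and_card_model (hD : b ^ 2 + 4 * a ≠ 0) :
    Finite (model a b).idealThreeTorsion ∧ Nat.card (model a b).idealThreeTorsion =
      ∑ m ∈ Finset.range ((b ^ 2 + 4 * a).natAbs + 1), rootCount (b ^ 2 + 4 * a) m := by
  classical
  obtain ⟨f, hf⟩ := bijective_cubeRoots hD
  let F : (model a b).IdealGroup ≃*
      (FractionalIdeal (QuadraticAlgebra ℤ a b)⁰ (QuadraticAlgebra ℚ a b))ˣ :=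
    Units.mapEquiv (FractionalIdeal.canonicalEquiv (QuadraticAlgebra ℤ a b)⁰
      (FractionRing (QuadraticAlgebra ℤ a b)) (QuadraticAlgebra ℚ a b)).toMulEquiv
  let G : (model a b).idealThreeTorsion ≃
      {I : (FractionalIdeal (QuadraticAlgebra ℤ a b)⁰ (QuadraticAlgebra ℚ a b))ˣ // I ^ 3 = 1} := by
    refine F.toEquiv.subtypeEquiv fun I => ?_
    change I ^ 3 = 1 ↔ F I ^ 3 = 1
    rw [← map_pow, map_eq_one_iff F F.injective]
  let H := (Equiv.ofBijective f hf).trans G.symm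
  refine ⟨Finite.of_equiv _ H, ?_⟩
  rw [← Nat.card_congr H, Nat.card_eq_fintype_card, Fintype.card_coe, Finset.card_sigma]
  rfl

end model

/-! ### Classification of quadratic orders -/

/-- Two orders `ℤ[ω]` with the same discriminant are isomorphic, through a translation of `ω`. -/
theorem nonempty_ringEquiv_of_discr_eq {a b a' b' : ℤ} (h : b ^ 2 + 4 * a = b' ^ 2 + 4 * a') :
    Nonempty (QuadraticAlgebra ℤ a b ≃+* QuadraticAlgebra ℤ a' b') := by
  have h2 : (2 : ℤ) ∣ b - b' := by
    have : Even ((b - b') ^ 2) := ⟨2 * a' - 2 * a + b' ^ 2 - b * b', by linear_combination h⟩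
    exact even_iff_two_dvd.1 ((Int.even_pow' two_ne_zero).1 this)
  obtain ⟨c, hc⟩ := h2
  obtain rfl : b = b' + 2 * c := by linear_combination hc
  have h3 : a' = a + b' * c + c ^ 2 := by
    refine mul_left_cancel₀ (four_ne_zero (α := ℤ)) ?_
    linear_combination -h
  let f := QuadraticAlgebra.lift (R := ℤ) (a := a) (b := b' + 2 * c)
    ⟨(⟨c, 1⟩ : QuadraticAlgebra ℤ a' b'), by
      ext
      · simp [h3]; ring
      · simp; ring⟩
  have hf (z) : f z = ⟨z.re + z.im * c, z.im⟩ := by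
    ext <;> simp [f]
  refine ⟨RingEquiv.ofBijective f ⟨fun x y hxy => ?_, fun z => ?_⟩⟩
  · rw [hf, hf, QuadraticAlgebra.mk.injEq] at hxy
    obtain ⟨h4, h5⟩ := hxy
    rw [h5] at h4
    exact QuadraticAlgebra.ext (add_right_cancel h4) h5
  · exact ⟨⟨z.re - z.im * c, z.im⟩, by rw [hf]; ext <;> simp⟩

/-- The element `1` of an order is part of a `ℤ`-basis. -/
theorem exists_omega (O : QuadraticOrder) : ∃ w : O.carrier,
    (∀ z : O.carrier, ∃ p q : ℤ, z = p + q * w) ∧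
    ∀ p q : ℤ, (p + q * w : O.carrier) = 0 → p = 0 ∧ q = 0 := by
  let B := Module.finBasisOfFinrankEq ℤ O.carrier O.finrank_eq_two
  have hsum (z : O.carrier) : z = B.repr z 0 * B 0 + B.repr z 1 * B 1 := by
    conv_lhs => rw [← B.sum_repr z, Fin.sum_univ_two, zsmul_eq_mul, zsmul_eq_mul]
  have hind (p q : ℤ) (h : (p * B 0 + q * B 1 : O.carrier) = 0) : p = 0 ∧ q = 0 := by
    have h1 := congrArg B.repr h
    rw [← zsmul_eq_mul, ← zsmul_eq_mul, map_add, map_zsmul, map_zsmul, B.repr_self, B.repr_self,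
      map_zero] at h1
    have h2 := DFunLike.congr_fun h1 0
    have h3 := DFunLike.congr_fun h1 1
    simp at h2 h3
    exact ⟨h2, h3⟩
  have h1 := hsum 1
  generalize B.repr 1 0 = x at h1
  generalize B.repr 1 1 = y at h1
  -- a common divisor of the coordinates of `1` is a unit, hence has norm `±1`
  have hcop : IsCoprime x y := by
    rw [Int.isCoprime_iff_gcd_eq_one]
    obtain ⟨x', hx⟩ := Int.gcd_dvd_left (a := x) (b := y)
    obtain ⟨y', hy⟩ := Int.gcd_dvd_right (a := x) (b := y)
    set g := Int.gcd x y
    have h2 : (1 : O.carrier) = algebraMap ℤ O.carrier g * (x' * B 0 + y' * B 1) := by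
      conv_lhs => rw [h1, hx, hy]
      push_cast [algebraMap_int_eq, eq_intCast]
      ring
    have h3 := congrArg (Algebra.norm ℤ) h2
    rw [map_one, map_mul, Algebra.norm_algebraMap, O.finrank_eq_two] at h3
    have h4 : (g : ℤ) ∣ 1 := (dvd_pow_self _ two_ne_zero).trans (Dvd.intro _ h3.symm)
    exact Nat.dvd_one.1 (by exact_mod_cast h4)
  obtain ⟨u, v, huv⟩ := hcop
  have huv' : (u * x + v * y : O.carrier) = 1 := by
    exact_mod_cast congrArg (Int.cast (R := O.carrier)) huv
  refine ⟨-v * B 0 + u * B 1, fun z => ?_, fun p q h => ?_⟩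
  · refine ⟨B.repr z 0 * u + B.repr z 1 * v, B.repr z 1 * x - B.repr z 0 * y, ?_⟩
    conv_lhs => rw [hsum z]
    generalize B.repr z 0 = r
    generalize B.repr z 1 = s
    push_cast
    linear_combination -(r * B 0 + s * B 1) * huv' - (r * u + s * v : O.carrier) * h1
  · have h2 := hind (p * x - q * v) (p * y + q * u) (by
      push_cast
      linear_combination h - (p : O.carrier) * h1)
    obtain ⟨h3, h4⟩ := h2
    constructor
    · linear_combination u * h3 + v * h4 - p * huv
    · linear_combination x * h4 - y * h3 - q * huv

/-- Every order in a quadratic field is of the form `ℤ[ω]`, with non-square discriminant. -/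
theorem exists_equiv_quadraticAlgebra (O : QuadraticOrder) : ∃ a b : ℤ,
    ¬ IsSquare (b ^ 2 + 4 * a) ∧ Nonempty (QuadraticAlgebra ℤ a b ≃+* O.carrier) := by
  obtain ⟨w, hspan, hind⟩ := O.exists_omega
  obtain ⟨a, b, hw⟩ := hspan (w * w)
  refine ⟨a, b, ?_, ?_⟩
  · rintro ⟨c, hc⟩
    have hc' : (b ^ 2 + 4 * a : O.carrier) = c * c := by exact_mod_cast congrArg Int.cast hc
    -- a square discriminant would give zero divisors
    have h1 : (((-b - c : ℤ) : O.carrier) + (2 : ℤ) * w) *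
        (((-b + c : ℤ) : O.carrier) + (2 : ℤ) * w) = 0 := by
      push_cast
      linear_combination 4 * hw + hc'
    rcases mul_eq_zero.1 h1 with h | h
    · exact two_ne_zero (hind _ _ h).2
    · exact two_ne_zero (hind _ _ h).2
  · let f := QuadraticAlgebra.lift (R := ℤ) (a := a) (b := b)
      ⟨w, by simpa [zsmul_eq_mul] using hw⟩
    have hf (z) : f z = z.re + z.im * w := by simp [f, zsmul_eq_mul]
    refine ⟨RingEquiv.ofBijective f ⟨(injective_iff_map_eq_zero f).2 fun z hz => ?_, fun z => ?_⟩⟩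
    · rw [hf] at hz
      exact QuadraticAlgebra.ext (hind _ _ hz).1 (hind _ _ hz).2
    · obtain ⟨p, q, rfl⟩ := hspan z
      exact ⟨⟨p, q⟩, hf _⟩

theorem exists_equiv_model (O : QuadraticOrder) : ∃ (a b : ℤ)
    (_ : Fact (∀ r : ℚ, r ^ 2 ≠ a + b * r)), ¬ IsSquare (b ^ 2 + 4 * a) ∧ model a b ≈ O := by
  obtain ⟨a, b, h, e⟩ := O.exists_equiv_quadraticAlgebra
  exact ⟨a, b, fact_of_not_isSquare h, h, e⟩

theorem discr_ne_zero_of_not_isSquare {D : ℤ} (h : ¬ IsSquare D) : D ≠ 0 := by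
  rintro rfl
  exact h IsSquare.zero

theorem card_idealThreeTorsion (O : QuadraticOrder) : Nat.card O.idealThreeTorsion =
    ∑ m ∈ Finset.range (O.discr.natAbs + 1), rootCount O.discr m := by
  obtain ⟨a, b, _, h, e⟩ := O.exists_equiv_model
  rw [← card_idealThreeTorsion_congr e, ← discr_congr e, model_discr]
  exact (finite_and_card_model (discr_ne_zero_of_not_isSquare h)).2

theorem finite_idealThreeTorsion (O : QuadraticOrder) : Finite O.idealThreeTorsion := by
  obtain ⟨a, b, _, h, e⟩ := O.exists_equiv_model
  have := (finite_and_card_model (discr_ne_zero_of_not_isSquare h)).1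
  refine Nat.finite_of_card_ne_zero ?_
  rw [← card_idealThreeTorsion_congr e]
  exact Nat.card_pos.ne'

/-- The discriminants of orders in quadratic fields. -/
def IsDiscr (D : ℤ) : Prop := (D % 4 = 0 ∨ D % 4 = 1) ∧ ¬ IsSquare D

end QuadraticOrder

namespace QuadraticOrderClass
open QuadraticOrder QuadraticAlgebra

theorem discr_injective : Function.Injective discr := by
  intro C C' h
  induction C using Quotient.inductionOn with | h O =>
  induction C' using Quotient.inductionOn with | h O' =>
  obtain ⟨a, b, _, -, e⟩ := O.exists_equiv_model
  obtain ⟨a', b', _, -, e'⟩ := O'.exists_equiv_model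
  change O.discr = O'.discr at h
  rw [← discr_congr e, ← discr_congr e', model_discr, model_discr] at h
  exact Quotient.sound (Setoid.trans (Setoid.symm e)
    (Setoid.trans (nonempty_ringEquiv_of_discr_eq h) e'))

theorem range_discr : Set.range discr = {D | IsDiscr D} := by
  ext D
  constructor
  · rintro ⟨C, rfl⟩
    induction C using Quotient.inductionOn with | h O =>
    obtain ⟨a, b, _, h, e⟩ := O.exists_equiv_model
    change IsDiscr O.discr
    rw [← discr_congr e, model_discr]
    refine ⟨?_, h⟩
    rcases Int.even_or_odd' b with ⟨c, rfl | rfl⟩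
    · left
      ring_nf
      omega
    · right
      ring_nf
      omega
  · rintro ⟨h, hs⟩
    have hD : (D % 4) ^ 2 + 4 * (D / 4) = D := by
      have := Int.emod_add_mul_ediv D 4
      rcases h with h | h <;> rw [h] at this ⊢ <;> linarith
    have := fact_of_not_isSquare (a := D / 4) (b := D % 4) (by rwa [hD])
    refine ⟨⟦model (D / 4) (D % 4)⟧, ?_⟩
    exact model_discr.trans hD

theorem numIdealThreeTorsion_eq (C : QuadraticOrderClass) : C.numIdealThreeTorsion =
    ∑ m ∈ Finset.range (C.discr.natAbs + 1), rootCount C.discr m := by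
  induction C using Quotient.inductionOn with | h O =>
  exact O.card_idealThreeTorsion

end QuadraticOrderClass

/-! ### Bounds for the number of roots -/

namespace QuadraticOrder

/-- The roots of `3 t² ≡ 3 t₀²` modulo `m` that are coprime to `m`, split by the common divisor of
`m` with `3 (t - t₀)`, lie in boundedly many classes: two with the same common divisor are congruent
modulo `m` up to a factor `18`. -/
theorem dvd_eighteen_mul_sub {m t t' t₀ : ℤ} (hm : 0 < m) (hc : IsCoprime m t)
    (h : m ∣ 3 * (t - t₀) * (t + t₀)) (h' : m ∣ 3 * (t' - t₀) * (t' + t₀))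
    (hg : Int.gcd m (3 * (t - t₀)) = Int.gcd m (3 * (t' - t₀))) : m ∣ 18 * (t - t') := by
  obtain ⟨e, he⟩ := Int.gcd_dvd_left (a := m) (b := 3 * (t - t₀))
  have hd0 : 0 < Int.gcd m (3 * (t - t₀)) := Int.gcd_pos_of_ne_zero_left _ hm.ne'
  have key {s : ℤ} (hs : m ∣ 3 * (s - t₀) * (s + t₀))
      (hgs : Int.gcd m (3 * (t - t₀)) = Int.gcd m (3 * (s - t₀))) : e ∣ s + t₀ := by
    obtain ⟨x, hx⟩ := Int.gcd_dvd_right (a := m) (b := 3 * (s - t₀))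
    rw [← hgs] at hx
    have hcop : IsCoprime e x := by
      rw [Int.isCoprime_iff_gcd_eq_one]
      have h1 := hgs
      nth_rw 2 [he] at h1
      rw [hx, Int.gcd_mul_left, Int.natAbs_natCast] at h1
      exact (Nat.eq_of_mul_eq_mul_left hd0 (by rw [mul_one]; exact h1)).symm
    refine hcop.dvd_of_dvd_mul_left ?_
    have hd0' : ((Int.gcd m (3 * (t - t₀)) : ℕ) : ℤ) ≠ 0 := by exact_mod_cast hd0.ne'
    refine Int.dvd_of_mul_dvd_mul_left hd0' ?_
    rw [← he, ← mul_assoc, ← hx]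
    exact hs
  have he1 := key h rfl
  have he2 := key h' hg
  have hd1 := Int.gcd_dvd_right (a := m) (b := 3 * (t - t₀))
  have hd2 := Int.gcd_dvd_right (a := m) (b := 3 * (t' - t₀))
  rw [← hg] at hd2
  set d : ℤ := ((Int.gcd m (3 * (t - t₀)) : ℕ) : ℤ)
  have hd : d ∣ 3 * (t - t') := by
    have := dvd_sub hd1 hd2
    rwa [show 3 * (t - t₀) - 3 * (t' - t₀) = 3 * (t - t') by ring] at this
  have he3 : e ∣ 3 * (t - t') := by
    have := dvd_sub he1 he2
    rw [show t + t₀ - (t' + t₀) = t - t' by ring] at this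
    exact this.mul_left _
  have hgcd : ((Int.gcd d e : ℕ) : ℤ) ∣ 6 := by
    have h1 : ((Int.gcd d e : ℕ) : ℤ) ∣ 6 * t := by
      have := dvd_add ((Int.gcd_dvd_left (a := d) (b := e)).trans hd1)
        (((Int.gcd_dvd_right (a := d) (b := e)).trans he1).mul_left 3)
      rwa [show 3 * (t - t₀) + 3 * (t + t₀) = 6 * t by ring] at this
    have h2 : IsCoprime ((Int.gcd d e : ℕ) : ℤ) t :=
      hc.of_isCoprime_of_dvd_left ((Int.gcd_dvd_left (a := d) (b := e)).trans ⟨e, he⟩)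
    exact h2.dvd_of_dvd_mul_right h1
  obtain ⟨u, hu⟩ := hd
  obtain ⟨v, hv⟩ := he3
  -- `d e` divides `gcd d e * 3 (t - t')` by Bézout
  have h3 : m ∣ (Int.gcd d e : ℕ) * (3 * (t - t')) := by
    rw [Int.gcd_eq_gcd_ab, he]
    refine ⟨Int.gcdA d e * v + Int.gcdB d e * u, ?_⟩
    linear_combination d * Int.gcdA d e * hv + e * Int.gcdB d e * hu
  refine h3.trans ?_
  obtain ⟨y, hy⟩ := hgcd
  exact ⟨y, by linear_combination 3 * (t - t') * hy⟩

/-- Given one root `t₀`, a root `t` is determined up to `36` possibilities by the divisor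
`gcd(m, 3 (t - t₀))` of `m`. -/
theorem rootCount_le (D : ℤ) (m : ℕ) : rootCount D m ≤ 36 * m.divisors.card := by
  classical
  rw [rootCount]
  rcases Finset.eq_empty_or_nonempty
    ((Finset.range (2 * m)).filter fun t : ℕ => IsCubeRootPair D m t) with h0 | ⟨t₀, ht₀⟩
  · simp [h0]
  have hp₀ := (Finset.mem_filter.1 ht₀).2
  have hm : (0 : ℤ) < m := hp₀.pos
  have hm' : 0 < m := by exact_mod_cast hm
  have hdvd {t : ℕ} (ht : IsCubeRootPair D m t) : (m : ℤ) ∣ 3 * ((t : ℤ) - t₀) * (t + t₀) := by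
    obtain ⟨k, hk⟩ := dvd_sub ht.dvd hp₀.dvd
    refine ⟨4 * k, mul_left_cancel₀ (pow_ne_zero 2 hm.ne') ?_⟩
    linear_combination hk
  refine Finset.card_le_mul_card_image_of_maps_to
    (f := fun t : ℕ => Int.gcd m (3 * ((t : ℤ) - t₀))) (fun t _ => ?_) 36 fun d _ => ?_
  · rw [Nat.mem_divisors]
    exact ⟨by exact_mod_cast Int.gcd_dvd_left (a := m) (b := 3 * ((t : ℤ) - t₀)), hm'.ne'⟩
  · rw [← Finset.card_range 36]
    -- two elements of `[0, 2m)` with the same value of `⌊18 t / m⌋` have `18 |t - t'| < m`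
    refine Finset.card_le_card_of_injOn (fun t => 18 * t / m) (fun t ht => ?_) ?_
    · simp only [Finset.coe_filter, Finset.mem_filter, Finset.mem_range] at ht
      simp only [Finset.coe_range, Set.mem_Iio]
      rw [Nat.div_lt_iff_lt_mul hm']
      have := ht.1.1
      change t < 2 * m at this
      omega
    · intro t ht t' ht' htt
      simp only [Finset.coe_filter, Finset.mem_filter] at ht ht'
      obtain ⟨⟨_, hp⟩, hd⟩ := ht
      obtain ⟨⟨_, hp'⟩, hd'⟩ := ht'
      have h1 := dvd_eighteen_mul_sub hm hp.coprime (hdvd hp) (hdvd hp') (hd.trans hd'.symm)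
      have h2 := Nat.div_add_mod (18 * t) m
      have h3 := Nat.div_add_mod (18 * t') m
      have h4 := Nat.mod_lt (18 * t) hm'
      have h5 := Nat.mod_lt (18 * t') hm'
      dsimp only at htt
      rw [htt] at h2
      have h6 := Int.eq_zero_of_abs_lt_dvd h1 (by rw [abs_lt]; omega)
      omega

/-! ### The contribution of each `m` -/

open Classical in
/-- The contribution of `m` to the sum of the numbers of cube roots over the orders of discriminant
`ε n` with `n < N`. -/
noncomputable def levelSum (ε : ℤ) (m N : ℕ) : ℕ :=
  ∑ n ∈ (Finset.range N).filter fun n : ℕ => ¬ IsSquare (ε * n), rootCount (ε * n) m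

variable {ε : ℤ}

theorem ne_zero_of_not_isSquare_mul {n : ℕ} (h : ¬ IsSquare (ε * n)) : n ≠ 0 := by
  rintro rfl
  simp at h

theorem levelSum_eq_zero_of_le (hε : ε.natAbs = 1) {m N : ℕ} (h : N ≤ m) : levelSum ε m N = 0 := by
  classical
  refine Finset.sum_eq_zero fun n hn => ?_
  rw [Finset.mem_filter, Finset.mem_range] at hn
  refine rootCount_eq_zero_of_lt (discr_ne_zero_of_not_isSquare hn.2) ?_
  rw [Int.natAbs_mul, hε, Int.natAbs_natCast]
  omega

/-- A bound for `levelSum` whose sum over `m` converges after division by `N`: `rootCount` is at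
most `36 d(m)`, and vanishes unless `m²` divides the discriminant. -/
theorem levelSum_div_le (hε : ε.natAbs = 1) (m N : ℕ) :
    (levelSum ε m N : ℝ) / N ≤ 36 * (m.divisors.card / (m : ℝ) ^ 2) := by
  classical
  rcases Nat.eq_zero_or_pos N with rfl | hN
  · simp only [CharP.cast_eq_zero, div_zero]; positivity
  rcases Nat.eq_zero_or_pos m with rfl | hm
  · simp [levelSum, rootCount]
  have h1 : levelSum ε m N ≤ (N / m ^ 2) * (36 * m.divisors.card) := by
    have hsub : levelSum ε m N ≤
        ∑ n ∈ (Finset.Ioc 0 N).filter fun n => m ^ 2 ∣ n, 36 * m.divisors.card := by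
      rw [levelSum]
      have hz (n : ℕ) (h : ¬ m ^ 2 ∣ n) : rootCount (ε * n) m = 0 := by
        rw [rootCount, Finset.card_eq_zero, Finset.filter_eq_empty_iff]
        intro t _ ht
        have h2 := Int.natAbs_dvd_natAbs.2 ht.sq_dvd
        rw [Int.natAbs_mul, hε, one_mul, Int.natAbs_natCast, Int.natAbs_pow,
          Int.natAbs_natCast] at h2
        exact h h2
      rw [← Finset.sum_filter_of_ne (p := fun n => m ^ 2 ∣ n)
        (fun n _ h => by by_contra h3; exact h (hz n h3))]
      refine (Finset.sum_le_sum fun n _ => rootCount_le _ _).trans ?_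
      refine Finset.sum_le_sum_of_subset fun n hn => ?_
      simp only [Finset.mem_filter, Finset.mem_range] at hn
      simp only [Finset.mem_filter, Finset.mem_Ioc]
      have := ne_zero_of_not_isSquare_mul hn.1.2
      exact ⟨⟨by omega, by omega⟩, hn.2⟩
    rwa [Finset.sum_const, Nat.Ioc_filter_dvd_card_eq_div, smul_eq_mul] at hsub
  have hN' : (0 : ℝ) < N := by exact_mod_cast hN
  have hm' : (0 : ℝ) < m := by exact_mod_cast hm
  rw [div_le_iff₀ hN']
  have h2 : (levelSum ε m N : ℝ) ≤ ((N / m ^ 2 : ℕ) : ℝ) * (36 * m.divisors.card) := by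
    exact_mod_cast h1
  refine h2.trans ?_
  have h3 : ((N / m ^ 2 : ℕ) : ℝ) ≤ N / (m : ℝ) ^ 2 := by
    exact_mod_cast Nat.cast_div_le (α := ℝ) (m := N) (n := m ^ 2)
  calc ((N / m ^ 2 : ℕ) : ℝ) * (36 * m.divisors.card)
      ≤ N / (m : ℝ) ^ 2 * (36 * m.divisors.card) := by gcongr
    _ = _ := by ring

theorem summable_card_divisors_div_sq :
    Summable fun m : ℕ => (m.divisors.card : ℝ) / (m : ℝ) ^ 2 := by
  have h1 : LSeriesSummable (1 : ℕ → ℂ) 2 := LSeriesSummable_one_iff.2 (by norm_num)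
  have h := (h1.convolution h1).norm
  refine h.congr fun m => ?_
  rcases eq_or_ne m 0 with rfl | hm
  · simp
  rw [LSeries.term_of_ne_zero hm, LSeries.convolution_def]
  simp only [Pi.one_apply, mul_one, Finset.sum_const, nsmul_eq_mul]
  rw [← Nat.map_div_right_divisors, Finset.card_map]
  simp

/-- The density of an arithmetic progression, with the squares removed. -/
theorem tendsto_progression (hε : ε.natAbs = 1) (c : ℤ) {r : ℕ} (hr : 0 < r) :
    Tendsto (fun N : ℕ => (((Finset.range N).filter
      fun n : ℕ => ¬ IsSquare (ε * n) ∧ (r : ℤ) ∣ ε * n + c).card : ℝ) / N)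
      atTop (𝓝 (1 / r)) := by
  classical
  have hεε : ε * ε = 1 := by
    rcases Int.natAbs_eq_iff.1 hε with h | h <;> simp [h]
  obtain ⟨v, hv⟩ : ∃ v : ℕ, ∀ n : ℕ, (r : ℤ) ∣ ε * n + c ↔ n ≡ v [MOD r] := by
    have h0 := Int.emod_nonneg (-(ε * c)) (b := r) (by omega)
    refine ⟨((-(ε * c)) % r).toNat, fun n => ?_⟩
    rw [← Int.natCast_modEq_iff, Int.toNat_of_nonneg h0]
    have h1 : (n : ℤ) ≡ -(ε * c) % r [ZMOD r] ↔ (n : ℤ) ≡ -(ε * c) [ZMOD r] := by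
      simp [Int.ModEq]
    rw [h1, Int.modEq_comm, Int.modEq_iff_dvd]
    constructor
    · rintro ⟨k, hk⟩
      exact ⟨ε * k, by linear_combination ε * hk - n * hεε⟩
    · rintro ⟨k, hk⟩
      exact ⟨ε * k, by linear_combination ε * hk - c * hεε⟩
  have hr' : (0 : ℝ) < r := by exact_mod_cast hr
  have hbound (N : ℕ) : |((((Finset.range N).filter
      fun n : ℕ => ¬ IsSquare (ε * n) ∧ (r : ℤ) ∣ ε * n + c).card : ℝ)) - N / r| ≤
      Nat.sqrt N + 2 := by
    have h1 := Finset.card_filter_add_card_filter_not (s := (Finset.range N).filter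
      fun n : ℕ => (r : ℤ) ∣ ε * n + c) (fun n : ℕ => ¬ IsSquare (ε * n))
    have h2 : ((Finset.range N).filter fun n : ℕ => (r : ℤ) ∣ ε * n + c).card =
        N / r + if v % r < N % r then 1 else 0 := by
      rw [← Nat.count_modEq_card _ hr, Nat.count_eq_card_filter_range]
      simp only [hv]
    rw [Finset.filter_filter, Finset.filter_filter, h2] at h1
    have h3 : ((Finset.range N).filter
        fun n : ℕ => (r : ℤ) ∣ ε * n + c ∧ ¬ ¬ IsSquare (ε * n)).card ≤ Nat.sqrt N + 1 := by
      rw [← Finset.card_range (Nat.sqrt N + 1)]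
      refine (Finset.card_le_card fun n hn => ?_).trans
        (Finset.card_image_le (f := fun k : ℕ => k * k))
      simp only [Finset.mem_filter, Finset.mem_range, not_not] at hn
      obtain ⟨hnN, -, s, hs⟩ := hn
      have h4 : n = s.natAbs * s.natAbs := by
        rw [← Int.natAbs_mul, ← hs, Int.natAbs_mul, hε, one_mul, Int.natAbs_natCast]
      refine Finset.mem_image.2 ⟨s.natAbs, ?_, h4.symm⟩
      rw [Finset.mem_range, Nat.lt_succ_iff, Nat.le_sqrt, ← h4]
      exact hnN.le
    have h5 : ((N / r : ℕ) : ℝ) ≤ N / r := Nat.cast_div_le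
    have h6 : (N : ℝ) / r < (N / r : ℕ) + 1 := by
      rw [div_lt_iff₀ hr']
      exact_mod_cast Nat.lt_mul_of_div_lt (Nat.lt_succ_self _) hr |>.trans_eq (by rw [mul_comm])
    simp only [and_comm (b := ¬ IsSquare _)] at h1
    have h7 : N / r ≤ ((Finset.range N).filter
        fun n : ℕ => ¬ IsSquare (ε * n) ∧ (r : ℤ) ∣ ε * n + c).card + (Nat.sqrt N + 1) := by
      split_ifs at h1 <;> omega
    have h8 : ((Finset.range N).filter
        fun n : ℕ => ¬ IsSquare (ε * n) ∧ (r : ℤ) ∣ ε * n + c).card ≤ N / r + 1 := by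
      split_ifs at h1 <;> omega
    have h7' : ((N / r : ℕ) : ℝ) ≤ ((Finset.range N).filter
        fun n : ℕ => ¬ IsSquare (ε * n) ∧ (r : ℤ) ∣ ε * n + c).card + (Nat.sqrt N + 1) := by
      exact_mod_cast h7
    have h8' : (((Finset.range N).filter
        fun n : ℕ => ¬ IsSquare (ε * n) ∧ (r : ℤ) ∣ ε * n + c).card : ℝ) ≤ (N / r : ℕ) + 1 := by
      exact_mod_cast h8
    have h9 : (0 : ℝ) ≤ Nat.sqrt N := Nat.cast_nonneg _
    rw [abs_le]
    constructor <;> linarith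
  rw [tendsto_iff_norm_sub_tendsto_zero]
  have hlim : Tendsto (fun N : ℕ => (√N)⁻¹ + 2 / (N : ℝ)) atTop (𝓝 0) := by
    rw [← add_zero (0 : ℝ)]
    refine Tendsto.add ?_ (tendsto_const_div_atTop_nhds_zero_nat 2)
    exact (Real.tendsto_sqrt_atTop.comp tendsto_natCast_atTop_atTop).inv_tendsto_atTop
  refine squeeze_zero' (Eventually.of_forall fun N => norm_nonneg _) ?_ hlim
  filter_upwards [eventually_gt_atTop 0] with N hN
  have hN' : (0 : ℝ) < N := by exact_mod_cast hN
  rw [Real.norm_eq_abs, show (1 : ℝ) / r = (N / r) / N by field_simp, ← sub_div, abs_div,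
    abs_of_pos hN', div_le_iff₀ hN']
  refine (hbound N).trans ?_
  have h1 : (√N)⁻¹ * (N : ℝ) = √N := by
    rw [inv_mul_eq_div, Real.div_sqrt]
  rw [add_mul, h1, div_mul_cancel₀ _ hN'.ne']
  gcongr
  exact Real.nat_sqrt_le_real_sqrt

theorem card_coprime_range_two_mul (m : ℕ) :
    ((Finset.range (2 * m)).filter fun t => m.Coprime t).card = 2 * m.totient := by
  rw [two_mul, Finset.range_eq_Ico,
    ← Finset.Ico_union_Ico_eq_Ico (Nat.zero_le m) (Nat.le_add_left m m),
    Finset.filter_union, Finset.card_union_of_disjoint, Nat.filter_coprime_Ico_eq_totient]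
  · have := Nat.filter_coprime_Ico_eq_totient m 0
    rw [zero_add] at this
    rw [this, two_mul]
  · exact Finset.disjoint_filter_filter (Finset.Ico_disjoint_Ico_consecutive _ _ _)

/-- The levels contribute in proportion to `φ(m) / m³`: there are `2 φ(m)` values of `t`, each of
which forces the discriminant into one class modulo `4 m³`. -/
theorem tendsto_levelSum_div (hε : ε.natAbs = 1) (m : ℕ) :
    Tendsto (fun N : ℕ => (levelSum ε m N : ℝ) / N) atTop
      (𝓝 (1 / 2 * (m.totient / (m : ℝ) ^ 3))) := by
  classical
  rcases Nat.eq_zero_or_pos m with rfl | hm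
  · simp [levelSum, rootCount]
  have h1 (N : ℕ) : levelSum ε m N = ∑ t ∈ (Finset.range (2 * m)).filter fun t => m.Coprime t,
      ((Finset.range N).filter fun n : ℕ =>
        ¬ IsSquare (ε * n) ∧ ((4 * m ^ 3 : ℕ) : ℤ) ∣ ε * n + 3 * m ^ 2 * t ^ 2).card := by
    have hiff (n t : ℕ) : IsCubeRootPair (ε * n) m t ↔
        m.Coprime t ∧ ((4 * m ^ 3 : ℕ) : ℤ) ∣ ε * n + 3 * m ^ 2 * t ^ 2 := by
      constructor
      · intro h
        exact ⟨Nat.isCoprime_iff_coprime.1 h.coprime, by exact_mod_cast h.dvd⟩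
      · intro h
        exact ⟨by exact_mod_cast hm, Nat.isCoprime_iff_coprime.2 h.1, by exact_mod_cast h.2⟩
    simp only [levelSum, rootCount, hiff]
    simp only [Finset.card_eq_sum_ones]
    refine Finset.sum_comm' fun n t => ?_
    simp only [Finset.mem_filter]
    tauto
  have h2 := tendsto_finsetSum ((Finset.range (2 * m)).filter fun t => m.Coprime t) fun t _ =>
    tendsto_progression hε (3 * (m : ℤ) ^ 2 * (t : ℤ) ^ 2) (r := 4 * m ^ 3) (by positivity)
  rw [Finset.sum_const, card_coprime_range_two_mul] at h2
  convert h2 using 2 with N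
  · rw [h1, Nat.cast_sum, Finset.sum_div]
  · have : (m : ℝ) ≠ 0 := by exact_mod_cast hm.ne'
    push_cast [nsmul_eq_mul]
    field_simp
    norm_num

/-! ### The sum over all `m` -/

theorem tsum_totient_div_cube :
    ((∑' m : ℕ, (m.totient : ℝ) / (m : ℝ) ^ 3 : ℝ) : ℂ) = riemannZeta 2 / riemannZeta 3 := by
  have h3 : (3 : ℂ) ≠ 0 := by norm_num
  have h3re : (1 : ℝ) < (3 : ℂ).re := by norm_num
  have hφ : LSeriesSummable (fun n => (n.totient : ℂ)) 3 := by
    refine LSeriesSummable_of_le_const_mul_rpow (x := 2) (by norm_num) ⟨1, fun n _ => ?_⟩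
    rw [show (2 : ℝ) - 1 = 1 by norm_num, Real.rpow_one, one_mul, Complex.norm_natCast]
    exact_mod_cast Nat.totient_le n
  have h1 : LSeriesSummable (1 : ℕ → ℂ) 3 := LSeriesSummable_one_iff.2 h3re
  have hconv := LSeries_convolution' hφ h1
  have hid : LSeries.convolution (fun n => (n.totient : ℂ)) 1 = fun n : ℕ => (n : ℂ) := by
    rw [LSeries.convolution_def]
    funext n
    simp only [Pi.one_apply, mul_one]
    rw [Nat.sum_divisorsAntidiagonal (f := fun d _ => (d.totient : ℂ))]
    exact_mod_cast Nat.sum_totient n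
  have hL (f : ℕ → ℂ) : LSeries f 3 = ∑' n : ℕ, f n / (n : ℂ) ^ 3 := by
    refine tsum_congr fun n => ?_
    rw [LSeries.term_of_ne_zero' h3]
    norm_cast
  rw [hid, LSeries_one_eq_riemannZeta h3re, hL, hL] at hconv
  have h2 : ∑' n : ℕ, (n : ℂ) / (n : ℂ) ^ 3 = riemannZeta 2 := by
    have := zeta_nat_eq_tsum_of_gt_one (k := 2) (by norm_num)
    push_cast at this
    rw [this]
    refine tsum_congr fun n => ?_
    rcases eq_or_ne n 0 with rfl | hn
    · simp
    · have : (n : ℂ) ≠ 0 := by exact_mod_cast hn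
      field_simp
  rw [h2] at hconv
  rw [hconv, mul_div_cancel_right₀ _ (riemannZeta_ne_zero_of_one_lt_re h3re)]
  push_cast
  rfl

/-- The pairs with `m = 1` detect the discriminants, which are each counted once: they correspond to
the trivial ideal. -/
theorem rootCount_one (D : ℤ) [Decidable (D % 4 = 0 ∨ D % 4 = 1)] :
    rootCount D 1 = if D % 4 = 0 ∨ D % 4 = 1 then 1 else 0 := by
  classical
  have h (t : ℕ) : IsCubeRootPair D (1 : ℕ) t ↔ 4 ∣ D + 3 * (t : ℤ) ^ 2 := by
    constructor
    · intro h
      simpa using h.dvd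
    · intro h
      exact ⟨by norm_num, by simpa using isCoprime_one_left, by simpa using h⟩
  simp only [rootCount, h]
  rw [mul_one, Finset.range_add_one, Finset.range_one, Finset.filter_insert,
    Finset.filter_singleton]
  simp only [Nat.cast_one, one_pow, Nat.cast_zero]
  split_ifs <;> simp <;> omega

open Classical in
/-- The `n < N` such that `ε n` is a discriminant. -/
noncomputable def discrBelow (ε : ℤ) (N : ℕ) : Finset ℕ :=
  (Finset.range N).filter fun n : ℕ => IsDiscr (ε * n)

theorem card_discrBelow (ε : ℤ) (N : ℕ) : (discrBelow ε N).card = levelSum ε 1 N := by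
  classical
  simp only [levelSum, rootCount_one, Finset.sum_boole, Nat.cast_id, Finset.filter_filter]
  rw [discrBelow]
  congr 1
  ext n
  simp only [Finset.mem_filter, IsDiscr, and_comm]

/-- A cube root of the order can only exist for discriminants congruent to `0` or `1` modulo `4`. -/
theorem rootCount_eq_zero_of_emod {D : ℤ} (h : ¬ (D % 4 = 0 ∨ D % 4 = 1)) (m : ℕ) :
    rootCount D m = 0 := by
  classical
  rw [rootCount, Finset.card_eq_zero, Finset.filter_eq_empty_iff]
  rintro t _ ⟨-, -, k, hk⟩
  obtain ⟨x, hx⟩ : ∃ x : ℤ, x = m * t := ⟨_, rfl⟩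
  have h1 : D + 3 * x ^ 2 = 4 * (m ^ 3 * k) := by rw [hx]; linear_combination hk
  generalize (m : ℤ) ^ 3 * k = y at h1
  rcases Int.even_or_odd' x with ⟨c, rfl | rfl⟩
  · ring_nf at h1
    omega
  · ring_nf at h1
    omega

/-- Restricting `n` to discriminants, and `m` to the range where `rootCount` can be nonzero, changes
nothing in the double sum. -/
theorem sum_discrBelow (hε : ε.natAbs = 1) (N : ℕ) :
    ∑ n ∈ discrBelow ε N, ∑ m ∈ Finset.range ((ε * n).natAbs + 1), rootCount (ε * n) m =
      ∑ m ∈ Finset.range N, levelSum ε m N := by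
  classical
  simp only [levelSum]
  rw [Finset.sum_comm]
  have hsub : discrBelow ε N ⊆ (Finset.range N).filter fun n : ℕ => ¬ IsSquare (ε * n) := by
    intro n hn
    rw [discrBelow, Finset.mem_filter] at hn
    exact Finset.mem_filter.2 ⟨hn.1, hn.2.2⟩
  rw [← Finset.sum_subset hsub]
  · refine Finset.sum_congr rfl fun n hn => ?_
    rw [discrBelow, Finset.mem_filter, Finset.mem_range] at hn
    refine Finset.sum_subset (fun m hm => ?_) fun m _ hm => ?_
    · rw [Finset.mem_range] at hm ⊢
      rw [Int.natAbs_mul, hε, Int.natAbs_natCast] at hm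
      omega
    · rw [Finset.mem_range] at hm
      exact rootCount_eq_zero_of_lt (discr_ne_zero_of_not_isSquare hn.2.2) (by omega)
  · intro n hn hn'
    rw [Finset.mem_filter] at hn
    refine Finset.sum_eq_zero fun m _ => rootCount_eq_zero_of_emod (fun h => hn' ?_) m
    rw [discrBelow, Finset.mem_filter]
    exact ⟨hn.1, h, hn.2⟩

/-- The average number of cube roots, over the discriminants of a given sign. -/
theorem tendsto_average (hε : ε.natAbs = 1) : Tendsto (fun N : ℕ =>
      ((∑ n ∈ discrBelow ε N, ∑ m ∈ Finset.range ((ε * n).natAbs + 1), rootCount (ε * n) m : ℕ) :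
        ℝ) / (discrBelow ε N).card) atTop (𝓝 (∑' m : ℕ, (m.totient : ℝ) / (m : ℝ) ^ 3)) := by
  have h1 := tendsto_tsum_of_dominated_convergence
    (summable_card_divisors_div_sq.mul_left 36) (tendsto_levelSum_div hε)
    (Eventually.of_forall fun N m => by
      rw [Real.norm_of_nonneg (by positivity)]
      exact levelSum_div_le hε m N)
  have h2 := h1.div (tendsto_levelSum_div hε 1) (by norm_num)
  rw [tsum_mul_left] at h2
  have h3 : (1 / 2 * ∑' m : ℕ, (m.totient : ℝ) / (m : ℝ) ^ 3) /
      (1 / 2 * ((Nat.totient 1 : ℕ) / ((1 : ℕ) : ℝ) ^ 3)) =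
      ∑' m : ℕ, (m.totient : ℝ) / (m : ℝ) ^ 3 := by
    rw [Nat.totient_one, Nat.cast_one, one_pow, div_one, mul_one, mul_comm,
      mul_div_cancel_right₀ _ (by norm_num)]
  rw [h3] at h2
  refine h2.congr' ?_
  filter_upwards [eventually_gt_atTop 0] with N hN
  have hN' : (N : ℝ) ≠ 0 := by exact_mod_cast hN.ne'
  rw [sum_discrBelow hε, card_discrBelow, Pi.div_apply, tsum_eq_sum (s := Finset.range N),
    ← Finset.sum_div, div_div_div_cancel_right₀ hN', Nat.cast_sum]
  intro m hm
  rw [levelSum_eq_zero_of_le hε (by simpa using hm)]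
  simp

end QuadraticOrder

/-! ### Averages over isomorphism classes -/

namespace QuadraticOrderClass
open QuadraticOrder

variable {ε : ℤ}

/-- The classes of orders whose discriminant has sign `ε` correspond to absolute values of
discriminants. -/
theorem bijOn_natAbs_discr (hε : ε.natAbs = 1) (X : ℝ) :
    Set.BijOn (fun C : QuadraticOrderClass => C.discr.natAbs)
      {C | 0 < ε * C.discr ∧ ((ε * C.discr : ℤ) : ℝ) < X} (discrBelow ε ⌈X⌉₊) := by
  classical
  have hεε : ε * ε = 1 := by
    rcases Int.natAbs_eq_iff.1 hε with h | h <;> simp [h]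
  have habs {D : ℤ} (h : 0 < ε * D) : ε * (D.natAbs : ℤ) = D ∧ (D.natAbs : ℤ) = ε * D := by
    have : (D.natAbs : ℤ) = ε * D := by
      rw [← Int.natAbs_of_nonneg h.le, Int.natAbs_mul, hε, one_mul]
    exact ⟨by rw [this, ← mul_assoc, hεε, one_mul], this⟩
  refine ⟨fun C hC => ?_, fun C hC C' hC' h => ?_, fun n hn => ?_⟩
  · rw [discrBelow, Finset.mem_coe, Finset.mem_filter, Finset.mem_range, Nat.lt_ceil,
      (habs hC.1).1]
    refine ⟨?_, ?_⟩
    · have := hC.2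
      rwa [← (habs hC.1).2, Int.cast_natCast] at this
    · have : C.discr ∈ Set.range discr := ⟨C, rfl⟩
      rwa [range_discr] at this
  · refine discr_injective ?_
    rw [← (habs hC.1).1, ← (habs hC'.1).1]
    exact congrArg (fun k : ℕ => ε * (k : ℤ)) h
  · rw [discrBelow, Finset.mem_coe, Finset.mem_filter, Finset.mem_range, Nat.lt_ceil] at hn
    have h1 : ε * (n : ℤ) ∈ Set.range discr := by rw [range_discr]; exact hn.2
    obtain ⟨C, hC⟩ := h1
    refine ⟨C, ⟨?_, ?_⟩, ?_⟩
    · rw [hC, ← mul_assoc, hεε, one_mul]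
      exact_mod_cast Nat.pos_of_ne_zero (ne_zero_of_not_isSquare_mul hn.2.2)
    · rw [hC, ← mul_assoc, hεε, one_mul]
      exact_mod_cast hn.1
    · change C.discr.natAbs = n
      rw [hC, Int.natAbs_mul, hε, one_mul, Int.natAbs_natCast]

theorem averageIdealThreeTorsion_eq (hε : ε.natAbs = 1) (X : ℝ) :
    averageIdealThreeTorsion {C | 0 < ε * C.discr ∧ ((ε * C.discr : ℤ) : ℝ) < X} =
      ((∑ n ∈ discrBelow ε ⌈X⌉₊, ∑ m ∈ Finset.range ((ε * n).natAbs + 1), rootCount (ε * n) m : ℕ)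
        : ℝ) / (discrBelow ε ⌈X⌉₊).card := by
  have hεε : ε * ε = 1 := by
    rcases Int.natAbs_eq_iff.1 hε with h | h <;> simp [h]
  have hbij := bijOn_natAbs_discr hε X
  rw [averageIdealThreeTorsion, hbij.ncard_eq, Set.ncard_coe_finset, Nat.cast_sum,
    ← finsum_mem_coe_finset]
  congr 1
  refine finsum_mem_eq_of_bijOn _ hbij fun C hC => ?_
  have h1 : ε * (C.discr.natAbs : ℤ) = C.discr := by
    have h0 : 0 < ε * C.discr := hC.1
    have : (C.discr.natAbs : ℤ) = ε * C.discr := by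
      rw [← Int.natAbs_of_nonneg h0.le, Int.natAbs_mul, hε, one_mul]
    rw [this, ← mul_assoc, hεε, one_mul]
  rw [h1, numIdealThreeTorsion_eq]

theorem tendsto_averageIdealThreeTorsion (hε : ε.natAbs = 1) :
    Tendsto (fun X : ℝ => ((averageIdealThreeTorsion
        {C | 0 < ε * C.discr ∧ ((ε * C.discr : ℤ) : ℝ) < X} : ℝ) : ℂ))
      atTop (𝓝 (riemannZeta 2 / riemannZeta 3)) := by
  rw [← tsum_totient_div_cube]
  refine (Complex.continuous_ofReal.tendsto _).comp ?_
  simp only [averageIdealThreeTorsion_eq hε]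
  exact (tendsto_average hε).comp tendsto_nat_ceil_atTop

theorem imaginaryBelow_eq (X : ℝ) :
    imaginaryBelow X = {C | 0 < -1 * C.discr ∧ ((-1 * C.discr : ℤ) : ℝ) < X} := by
  simp only [imaginaryBelow, neg_one_mul]

theorem realBelow_eq (X : ℝ) :
    realBelow X = {C | 0 < 1 * C.discr ∧ ((1 * C.discr : ℤ) : ℝ) < X} := by
  simp only [realBelow, one_mul]

end QuadraticOrderClass

theorem theorem5 :
    -- the quantities that are averaged, and the sets they are averaged over, are finite
    (∀ O : QuadraticOrder, Finite O.idealThreeTorsion) ∧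
    (∀ X : ℝ, (QuadraticOrderClass.imaginaryBelow X).Finite ∧
      (QuadraticOrderClass.realBelow X).Finite) ∧
    -- imaginary quadratic orders
    Tendsto
      (fun X : ℝ => ((QuadraticOrderClass.averageIdealThreeTorsion
        (QuadraticOrderClass.imaginaryBelow X) : ℝ) : ℂ))
      atTop (𝓝 (riemannZeta 2 / riemannZeta 3)) ∧
    -- real quadratic orders
    Tendsto
      (fun X : ℝ => ((QuadraticOrderClass.averageIdealThreeTorsion
        (QuadraticOrderClass.realBelow X) : ℝ) : ℂ))
      atTop (𝓝 (riemannZeta 2 / riemannZeta 3)) := by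
  refine ⟨QuadraticOrder.finite_idealThreeTorsion, fun X => ⟨?_, ?_⟩, ?_, ?_⟩
  · rw [QuadraticOrderClass.imaginaryBelow_eq,
      (QuadraticOrderClass.bijOn_natAbs_discr (by norm_num) X).finite_iff_finite]
    exact Finset.finite_toSet _
  · rw [QuadraticOrderClass.realBelow_eq,
      (QuadraticOrderClass.bijOn_natAbs_discr (by norm_num) X).finite_iff_finite]
    exact Finset.finite_toSet _
  · simp only [QuadraticOrderClass.imaginaryBelow_eq]
    exact QuadraticOrderClass.tendsto_averageIdealThreeTorsion (by norm_num)
  · simp only [QuadraticOrderClass.realBelow_eq]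
    exact QuadraticOrderClass.tendsto_averageIdealThreeTorsion (by norm_num)
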